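/- **Setting.** Let $M$ be an episodic two-player zero-sum Markov game with horizon $H\ge 1$, state space $\mathcal S$, fixed initial state $s_1$, action spaces $\mathcal A$ (max-player) and $\mathcal B$ (min-player), transition kernels $\mathbb P_h$ and deterministic rewards $r_h$ with $\sum_{h=1}^H r_h(s_h,a_h,b_h)\in[0,1]$ for all sequences; an MDP is the case in which $\mathcal B$ has one element. Let $V^{\upsilon,\mu}_h,Q^{\upsilon,\mu}_h$ be the value functions of a pair of Markov policies and $V^*_h,Q^*_h$ those of a Nash equilibrium (for an MDP: of an optimal policy). Put $\eta_h=(s_h,a_h,b_h)$ and $\zeta_h=s_{h+1}$; $\mathbb E_{\zeta_h}$ denotes expectation over $\zeta_h\sim\mathbb P_h(\cdot\mid\eta_h)$. Let $\mathcal F\subseteq\mathcal G$ be hypothesis classes. Each $f\in\mathcal F$ has action-value functions $Q_{h,f}$, a pair $(\upsilon_f,\mu_f)$ of policies forming a Nash equilibrium of $Q_{h,f}(s,\cdot,\cdot)$ for all $h,s$ (for an MDP: a greedy policy), and $V_{h,f}(s)=\mathbb E_{a\sim\upsilon_f,b\sim\mu_f}Q_{h,f}(s,a,b)$. Some $f^*\in\mathcal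 F$ satisfies $Q_{h,f^*}=Q_h^*$ and $V_{h,f^*}=V_h^*$ for all $h$. Let $\ell_{h,f'}(\zeta_h,\eta_h,f,g)\in\mathbb R^p$ ($f,f'\in\mathcal F$, $g\in\mathcal G$) be a loss with $\|\ell\|_2\le R$ that is decomposable: there is $\mathcal T:\mathcal F\to\mathcal G$ with $\mathcal T(f^*)=f^*$ and $\ell_{h,f'}(\zeta_h,\eta_h,f,g)-\mathbb E_{\zeta_h}[\ell_{h,f'}(\zeta_h,\eta_h,f,g)]=\ell_{h,f'}(\zeta_h,\eta_h,f,\mathcal T(f))$. Let $K\ge2$ and let $d,\kappa\ge0$ be such that, with a constant $C_{\mathrm{el}}>0$: (i) ($\ell_2$-type eluder condition) for all $\beta\ge R^2$, all $h$, all $f^1,\dots,f^K\in\mathcal F$ and all $\eta_h^1,\dots,\eta_h^K$: if $\sum_{i=1}^{k-1}\|\mathbb E_{\zeta_h}[\ell_{h,f^i}(\zeta_h,\eta_h^i,f^k,f^k)]\|_2^2\le\beta$ for all $k\in[K]$, then $\sum_{i=1}^{k}\|\mathbb E_{\zeta_h}[\ell_{h,f^i}(\zeta_h,\eta_h^i,f^i,f^i)]\|_2^2\le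 C_{\mathrm{el}}\,d\beta\log(k+1)$ for all $k\in[K]$; (ii) ($\kappa$-dominance) for the hypotheses $f^i$ and policies $\pi^i$ of the algorithm below and every $k\in[K]$, with probability at least $1-\delta_1$, $$\sum_{i=1}^k\bigl(V_{1,f^i}(s_1)-V_1^{\pi^i}(s_1)\bigr)\le\kappa\sum_{h=1}^H\sum_{i=1}^k\mathbb E_{\eta_h\sim\pi^i}\bigl\|\mathbb E_{\zeta_h}[\ell_{h,f^i}(\zeta_h,\eta_h,f^i,f^i)]\bigr\|_2 .$$ Let $\mathcal N$ be the $1/K$-covering number, assumed finite, of the class of the functions $(f',\zeta,\eta)\mapsto\ell_{h,f'}(\zeta,\eta,f,g)$, $(h,f,g)\in[H]\times\mathcal F\times\mathcal G$, in the supremum norm (by elements of the class). **Algorithm ($\ell_2$-EC-Batch).** Let $B\in[K]$, $\beta\ge0$ and $o\in\{0,1\}$, and start with $\mathscr B^0=\mathcal F$. In episode $k=1,\dots,K$ choose $f^k\in\arg\max_{f\in\mathscr B^{k-1}}V_{1,f}(s_1)$, keeping $f^k=f^{k-1}$ if the confidence set was not recomputed after episode $k-1$; the adversary chooses a policy $\mu^k$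 depending on the past; play $\pi^k=(\upsilon_{f^k},\mu^k)$ and observe $(\zeta_h^k,\eta_h^k)_{h\in[H]}$. If $k=i\lfloor K/B\rfloor+o$ for some integer $i\ge0$, recompute $$\mathscr B^k=\Bigl\{f\in\mathcal F:\ L_h^{1:k}(f,f)-\inf_{g\in\mathcal G}L_h^{1:k}(f,g)\le\beta\ \ \forall h\in[H]\Bigr\},\qquad L_h^{1:k}(f,g)=\sum_{i=1}^k\|\ell_{h,f^i}(\zeta_h^i,\eta_h^i,f,g)\|_2^2 ;$$ otherwise $\mathscr B^k=\mathscr B^{k-1}$. **Theorem.** There is an absolute constant $c_0>0$, and for all $R\ge 0$ and $C_{\mathrm{el}}>0$ there is a constant $C$ depending only on $R$ and $C_{\mathrm{el}}$, such that in the above setting, for every $\delta\in(0,1)$, every $\delta_1\ge0$ and every $c\ge c_0$, if the algorithm is run with $\beta=c(R^2\iota+R)$, $\iota=\log(HK^2\mathcal N/\delta)$, then with probability at least $1-\delta-\delta_1$ (hence at least $1-\delta$ if the dominance inequality holds almost surely) $$\sum_{k=1}^K\bigl(V_1^*(s_1)-V_1^{\pi^k}(s_1)\bigr)\le C\Bigl(\kappa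 H\sqrt{d\beta K}\,\log K+\kappa\,\frac{dHK}{B}(\log K)^2\Bigr).$$ -/

import Mathlib

open MeasureTheory ProbabilityTheory
open scoped UniformConvergence

/-! ## Episodic zero-sum Markov games and MDPs

Steps are numbered `h = 0, …, H - 1` (so the first step has index `0`). Step-dependent objects are
indexed by `ℕ`, and their entries with index `≥ H` are never used. -/

/-- An episodic zero-sum Markov game with horizon `H`, state space `S`, action spaces `A` of the
max-player and `B` of the min-player, transition kernels and deterministic rewards whose sum over an
episode always lies in `[0, 1]`. An episodic MDP is the case in which `B` is a one-point type. -/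
structure MarkovGame (S A B : Type*) [MeasurableSpace S] [MeasurableSpace A] [MeasurableSpace B]
    (H : ℕ) where
  trans : ℕ → Kernel (S × A × B) S
  markov_trans : ∀ h, IsMarkovKernel (trans h)
  reward : ℕ → S × A × B → ℝ
  measurable_reward : ∀ h, Measurable (reward h)
  sum_reward_mem : ∀ x : ℕ → S × A × B,
    ∑ h ∈ Finset.range H, reward h (x h) ∈ Set.Icc (0 : ℝ) 1

/-- A (possibly randomized) Markov policy of one player: a Markov kernel from states to actions for
each step. -/
structure MarkovPolicy (S A : Type*) [MeasurableSpace S] [MeasurableSpace A] where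
  act : ℕ → Kernel S A
  markov_act : ∀ h, IsMarkovKernel (act h)

/-- The data of `n` consecutive steps: entry `j` is the pair `(η, ζ)` made of the state and the
actions `η = (s, a, b)` at that step and of the next state `ζ = s'`. -/
abbrev Trajectory (S A B : Type*) (n : ℕ) : Type _ := Fin n → (S × A × B) × S

section Game

variable {S A B : Type*} [MeasurableSpace S] [MeasurableSpace A] [MeasurableSpace B] {H : ℕ}

/-- The law of `((s, a, b), s')` at step `h`, given `s`: the players draw `a` and `b` independently
from their policies, and then `s'` is drawn from the transition kernel. -/
noncomputable def MarkovGame.stepKernel (M : MarkovGame S A B H) (υ : MarkovPolicy S A)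
    (μ : MarkovPolicy S B) (h : ℕ) : Kernel S ((S × A × B) × S) :=
  (Kernel.id ×ₖ (υ.act h ×ₖ μ.act h)) ⊗ₖ Kernel.prodMkLeft S (M.trans h)

/-- The law of the next `n` steps when the game is in state `s` at step `h`. -/
noncomputable def MarkovGame.rollout (M : MarkovGame S A B H) (υ : MarkovPolicy S A)
    (μ : MarkovPolicy S B) : (n : ℕ) → ℕ → Kernel S (Trajectory S A B n)
  | 0, _ => Kernel.const S (Measure.dirac Fin.elim0)
  | n + 1, h =>
    (M.stepKernel υ μ h ⊗ₖ
      Kernel.prodMkLeft S (Kernel.prodMkLeft (S × A × B) (M.rollout υ μ n (h + 1)))).map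
      (fun p => (Fin.cons p.1 p.2 : Trajectory S A B (n + 1)))

/-- `V_h^{υ,μ}(s)`: expected sum of the rewards of the steps `h, …, H - 1` from state `s`. -/
noncomputable def MarkovGame.value (M : MarkovGame S A B H) (υ : MarkovPolicy S A)
    (μ : MarkovPolicy S B) (h : ℕ) (s : S) : ℝ :=
  ∫ τ, ∑ j : Fin (H - h), M.reward (h + j) (τ j).1 ∂(M.rollout υ μ (H - h) h s)

/-- `Q_h^{υ,μ}(s,a,b)`. -/
noncomputable def MarkovGame.actionValue (M : MarkovGame S A B H) (υ : MarkovPolicy S A)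
    (μ : MarkovPolicy S B) (h : ℕ) (x : S × A × B) : ℝ :=
  M.reward h x + ∫ s', M.value υ μ (h + 1) s' ∂(M.trans h x)

/-- `(υ, μ)` is a Nash equilibrium of the game started in `s₁`. If `B` is a one-point type, this says
that `υ` is an optimal policy. -/
def MarkovGame.IsNash (M : MarkovGame S A B H) (s₁ : S) (υ : MarkovPolicy S A)
    (μ : MarkovPolicy S B) : Prop :=
  (∀ υ', M.value υ' μ 0 s₁ ≤ M.value υ μ 0 s₁) ∧ (∀ μ', M.value υ μ 0 s₁ ≤ M.value υ μ' 0 s₁)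

end Game

/-! ## Hypotheses -/

/-- What a hypothesis `f` of the class `F` provides: the action-value function `Q_f` (in the
model-based case, that of the model `M_f`) and the policy pair `(υ_f, μ_f)` computed from it. -/
structure HypothesisData (S A B F : Type*) [MeasurableSpace S] [MeasurableSpace A]
    [MeasurableSpace B] where
  Q : F → ℕ → S × A × B → ℝ
  maxPolicy : F → MarkovPolicy S A
  minPolicy : F → MarkovPolicy S B

section Hypotheses

variable {S A B F : Type*} [MeasurableSpace S] [MeasurableSpace A] [MeasurableSpace B]

/-- `V_{h,f}(s)`, the expectation of `Q_{h,f}(s, ·, ·)` under `(υ_f, μ_f)`. -/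
noncomputable def HypothesisData.V (D : HypothesisData S A B F) (f : F) (h : ℕ) (s : S) : ℝ :=
  ∫ x, D.Q f h (s, x.1, x.2) ∂(((D.maxPolicy f).act h s).prod ((D.minPolicy f).act h s))

/-- For every `f`, step `h` and state `s`, the pair `(υ_f, μ_f)` is a Nash equilibrium of the
zero-sum matrix game `Q_{h,f}(s, ·, ·)` (tested, equivalently, on pure deviations). If `B` is a
one-point type, this says that `υ_f` is a greedy policy with respect to `Q_f`. -/
structure HypothesisData.IsGreedy (D : HypothesisData S A B F) (H : ℕ) : Prop where
  integrable : ∀ f, ∀ h < H, ∀ s, Integrable (fun x : A × B => D.Q f h (s, x.1, x.2))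
    (((D.maxPolicy f).act h s).prod ((D.minPolicy f).act h s))
  integrable_min : ∀ f, ∀ h < H, ∀ s a,
    Integrable (fun b => D.Q f h (s, a, b)) ((D.minPolicy f).act h s)
  integrable_max : ∀ f, ∀ h < H, ∀ s b,
    Integrable (fun a => D.Q f h (s, a, b)) ((D.maxPolicy f).act h s)
  le_value : ∀ f, ∀ h < H, ∀ s a, ∫ b, D.Q f h (s, a, b) ∂((D.minPolicy f).act h s) ≤ D.V f h s
  value_le : ∀ f, ∀ h < H, ∀ s b, D.V f h s ≤ ∫ a, D.Q f h (s, a, b) ∂((D.maxPolicy f).act h s)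

/-- Realizability by `f`: `Q_{h,f} = Q_h^*` and `V_{h,f} = V_h^*` for all `h`, where `(υ, μ)` is the
Nash equilibrium that defines `Q^*` and `V^*`. -/
def HypothesisData.Realizes (D : HypothesisData S A B F) {H : ℕ} (M : MarkovGame S A B H)
    (υ : MarkovPolicy S A) (μ : MarkovPolicy S B) (f : F) : Prop :=
  ∀ h < H, (∀ x, D.Q f h x = M.actionValue υ μ h x) ∧ (∀ s, D.V f h s = M.value υ μ h s)

end Hypotheses

/-! ## Loss functions and the eluder condition

The hypothesis classes are a type `G` and a subset `F : Set G`. -/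

/-- `ℓ h f' ζ η f g` is the loss `ℓ_{h,f'}(ζ_h, η_h, f, g)`, a vector with its Euclidean norm. -/
abbrev LossFunction (S A B : Type*) {G : Type*} (F : Set G) (H p : ℕ) : Type _ :=
  Fin H → F → S → S × A × B → F → G → EuclideanSpace ℝ (Fin p)

section Loss

variable {S A B G : Type*} [MeasurableSpace S] [MeasurableSpace A] [MeasurableSpace B]
  {F : Set G} {H p : ℕ}

/-- `𝔼_{ζ_h}[ℓ_{h,f'}(ζ_h, η, f, g)]`, where `ζ_h` is the next state given `η = (s, a, b)`. -/
noncomputable def meanLoss (M : MarkovGame S A B H) (ℓ : LossFunction S A B F H p) (h : Fin H)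
    (f' : F) (η : S × A × B) (f : F) (g : G) : EuclideanSpace ℝ (Fin p) :=
  ∫ ζ, ℓ h f' ζ η f g ∂(M.trans h η)

/-- The loss is bounded by `R` and measurable in the arguments over which expectations are taken. -/
structure IsBoundedLoss [MeasurableSpace G] (ℓ : LossFunction S A B F H p) (R : ℝ) : Prop where
  norm_le : ∀ h f' ζ η f g, ‖ℓ h f' ζ η f g‖ ≤ R
  measurable : ∀ h f g, Measurable (fun x : F × S × (S × A × B) => ℓ h x.1 x.2.1 x.2.2 f g)
  measurable_diag : ∀ h,
    Measurable (fun x : F × S × (S × A × B) => ℓ h x.1 x.2.1 x.2.2 x.1 (x.1 : G))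

/-- The loss is decomposable with an operator `T : F → G` that fixes `fstar`. -/
def IsDecomposable (M : MarkovGame S A B H) (ℓ : LossFunction S A B F H p) (fstar : F) : Prop :=
  ∃ T : F → G, T fstar = fstar ∧
    ∀ h f' ζ η f g, ℓ h f' ζ η f g - meanLoss M ℓ h f' η f g = ℓ h f' ζ η f (T f)

/-- The `ℓ₂`-type eluder condition for `K` hypotheses. `Cel` is the constant hidden in the bound
`O(d β log k)`; `log (k + 1)` instead of `log k` only matters for `k = 1`, where `log k` vanishes. -/
def L2EluderCondition (M : MarkovGame S A B H) (ℓ : LossFunction S A B F H p) (R Cel d : ℝ)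
    (K : ℕ) : Prop :=
  ∀ β : ℝ, R ^ 2 ≤ β → ∀ h : Fin H, ∀ (f : ℕ → F) (η : ℕ → S × A × B),
    (∀ k ∈ Finset.Icc 1 K,
      ∑ i ∈ Finset.Ico 1 k, ‖meanLoss M ℓ h (f i) (η i) (f k) (f k)‖ ^ 2 ≤ β) →
    ∀ k ∈ Finset.Icc 1 K,
      ∑ i ∈ Finset.Icc 1 k, ‖meanLoss M ℓ h (f i) (η i) (f i) (f i)‖ ^ 2 ≤
        Cel * (d * β * Real.log (k + 1))

/-- The loss class: the functions `(f', ζ, η) ↦ ℓ_{h,f'}(ζ, η, f, g)` for all `h, f, g`, with the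
supremum distance. -/
def lossClass (ℓ : LossFunction S A B F H p) :
    Set ((F × S × (S × A × B)) →ᵤ EuclideanSpace ℝ (Fin p)) :=
  {φ | ∃ h f g, φ = UniformFun.ofFun (fun x => ℓ h x.1 x.2.1 x.2.2 f g)}

/-! ## The algorithm -/

/-- `L_h^{1:k}(D_h^{1:k}, f, g)` for the data of the episodes `1, …, k`, in which the hypotheses
`fs i` were used and the trajectories `τs i` were observed. -/
noncomputable def empLoss (ℓ : LossFunction S A B F H p) (fs : ℕ → F)
    (τs : ℕ → Trajectory S A B H) (h : Fin H) (k : ℕ) (f : F) (g : G) : ℝ :=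
  ∑ i ∈ Finset.Icc 1 k, ‖ℓ h (fs i) (τs i h).2 (τs i h).1 f g‖ ^ 2

/-- The grid: the confidence set is recomputed after the episodes `k = i m + o`, `i ≥ 0`, where
`m = ⌊K / B⌋` is the batch length. For `o = 0` the batches are `{i m + 1, …, (i + 1) m}`; for `o = 1`
the set used from episode `k + 1` on changes at `k = i m + 1`. -/
def IsUpdate (m o k : ℕ) : Prop := ∃ i : ℕ, k = i * m + o

open Classical in
/-- The confidence set after episode `k`, as a function of the data. -/
noncomputable def confidenceSet (ℓ : LossFunction S A B F H p) (β : ℝ) (m o : ℕ) (fs : ℕ → F)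
    (τs : ℕ → Trajectory S A B H) : ℕ → Set F
  | 0 => Set.univ
  | k + 1 =>
    if IsUpdate m o (k + 1) then
      {f | ∀ h, empLoss ℓ fs τs h (k + 1) f f - ⨅ g : G, empLoss ℓ fs τs h (k + 1) f g ≤ β}
    else confidenceSet ℓ β m o fs τs k

/-- `K` episodes of the uniform-grid batch algorithm with confidence parameter `β`, batch length `m`
and grid offset `o`, on a probability space with a filtration `ℱ` (`ℱ k` is the information after
episode `k`): `f k` is the hypothesis and `τ k` the trajectory of episode `k`, and `ν k` is the policy
that the adversary chooses for episode `k` from the past, in an arbitrary way. -/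
structure IsBatchRun [MeasurableSpace G] (M : MarkovGame S A B H) (D : HypothesisData S A B F)
    (ℓ : LossFunction S A B F H p) (s₁ : S) (β : ℝ) (K m o : ℕ)
    {Ω : Type*} {mΩ : MeasurableSpace Ω} (Pr : Measure Ω) (ℱ : Filtration ℕ mΩ)
    (f : ℕ → Ω → F) (ν : ℕ → Ω → MarkovPolicy S B) (τ : ℕ → Ω → Trajectory S A B H) :
    Prop where
  measurable_f : ∀ k ∈ Finset.Icc 1 K, Measurable[ℱ (k - 1)] (f k)
  measurable_traj : ∀ k ∈ Finset.Icc 1 K, Measurable[ℱ k] (τ k)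
  /-- Given the past, the trajectory of episode `k` is generated by the game `M`, started in `s₁`,
  under the policies `(υ_{f k}, ν k)`. -/
  law : ∀ k ∈ Finset.Icc 1 K, ∀ E : Set (Trajectory S A B H), MeasurableSet E →
    Pr⟦τ k ⁻¹' E | ℱ (k - 1)⟧ =ᵐ[Pr]
      fun ω => (M.rollout (D.maxPolicy (f k ω)) (ν k ω) H 0 s₁).real E
  /-- Optimistic planning: `f k` maximizes `V_{1,f}(s₁)` over the current confidence set. (If that set
  is empty, the algorithm may use any hypothesis.) -/
  optimistic : ∀ k ∈ Finset.Icc 1 K, ∀ᵐ ω ∂Pr,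
    (confidenceSet ℓ β m o (fun i => f i ω) (fun i => τ i ω) (k - 1)).Nonempty →
      f k ω ∈ confidenceSet ℓ β m o (fun i => f i ω) (fun i => τ i ω) (k - 1) ∧
      ∀ g ∈ confidenceSet ℓ β m o (fun i => f i ω) (fun i => τ i ω) (k - 1),
        D.V g 0 s₁ ≤ D.V (f k ω) 0 s₁
  /-- The hypothesis, hence the policy, is kept until the confidence set is recomputed. -/
  keep : ∀ k ∈ Finset.Icc 1 K, k + 1 ≤ K → ¬ IsUpdate m o k → ∀ᵐ ω ∂Pr, f (k + 1) ω = f k ω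

/-- `κ`-dominance, with failure probability `δ₁`, for the hypotheses `f i` and the policies
`π_i = (υ_{f i}, ν i)` of a run. -/
def Dominance (M : MarkovGame S A B H) (D : HypothesisData S A B F)
    (ℓ : LossFunction S A B F H p) (s₁ : S) (κ δ₁ : ℝ) (K : ℕ)
    {Ω : Type*} {mΩ : MeasurableSpace Ω} (Pr : Measure Ω)
    (f : ℕ → Ω → F) (ν : ℕ → Ω → MarkovPolicy S B) : Prop :=
  ∀ k ∈ Finset.Icc 1 K, 1 - δ₁ ≤ Pr.real {ω |
    ∑ i ∈ Finset.Icc 1 k,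
        (D.V (f i ω) 0 s₁ - M.value (D.maxPolicy (f i ω)) (ν i ω) 0 s₁) ≤
      κ * ∑ h : Fin H, ∑ i ∈ Finset.Icc 1 k,
        ∫ t, ‖meanLoss M ℓ h (f i ω) (t h).1 (f i ω) (f i ω)‖
          ∂(M.rollout (D.maxPolicy (f i ω)) (ν i ω) H 0 s₁)}

/-- The regret over `K` episodes; `(υstar, μstar)` is the Nash equilibrium that defines `V^*`. -/
noncomputable def regret (M : MarkovGame S A B H) (D : HypothesisData S A B F) (s₁ : S)
    (υstar : MarkovPolicy S A) (μstar : MarkovPolicy S B) (K : ℕ) (fs : ℕ → F)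
    (νs : ℕ → MarkovPolicy S B) : ℝ :=
  ∑ k ∈ Finset.Icc 1 K,
    (M.value υstar μstar 0 s₁ - M.value (D.maxPolicy (fs k)) (νs k) 0 s₁)

end Loss

/-!
# Regret of the `ℓ₂`-eluder batch algorithm

Write `w` for the loss vector `ℓ_{h,f^i}(ζ^i, η^i, f, g)` and `v` for its mean over `ζ^i` given `η^i`.
By decomposability, `w - v` is the loss at `T f`, so differences of empirical losses are sums of
`‖w‖² - ‖w - v‖² = 2⟪v, w⟫ - ‖v‖²`, with conditional mean `‖v‖²`. Hoeffding's lemma, applied to `⟪v, w⟫`,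
whose range has length `2R‖v‖`, gives `E exp ((‖v‖²/2 - (‖w‖² - ‖w - v‖²)) / (4R²)) ≤ 1`
(`lintegral_exp_excess_le_one`). The variance proxy is proportional to `‖v‖²` and is absorbed by the
mean, so that a plain exponential supermartingale with a fixed parameter suffices: up to an event of
probability `exp (-ι)`, the sum of the `‖v‖²/2` exceeds the drop of the empirical loss by at most
`4R²ι`. A union bound over the steps, the episodes and a `1/K`-cover of the loss class makes this
uniform at an additional cost of `7R` (`IsBatchRun.measure_exists_lt_sum_excess`). Hence `fstar` stays
in all confidence sets, which gives optimism, and the members of a confidence set have a squared mean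
loss of at most `4β` on the data from which the set was computed.

For the sum of the losses along the run, call an episode regular if the loss accumulated before it in
its own batch is at most `4β`. The regular episodes satisfy the premise of the eluder condition with
`8β`, since the hypothesis is constant on a batch. Every batch with an irregular episode has a loss of
more than `4β` on its regular ones, so there are at most `O(d log K)` such batches, each of at most
`⌊K / B⌋` episodes (`sum_norm_meanLoss_le`). The expected losses that occur in the dominance
inequality are compared with the observed ones by a second exponential supermartingale
(`measure_lt_sum_integral`). Its deviation term is proportional to the largest mean loss, which is
`O(R √d)` by the eluder condition itself (`L2EluderCondition.norm_meanLoss_le`), and so it is dominated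
by `√(dβK)`.

The policies of the adversary are not assumed to depend measurably on `ω`, so the laws of the
trajectories do not form a kernel. Conditional integrals are therefore obtained from the conditional
probabilities of single events by a π-λ argument (`lintegral_of_conditional_law`).
-/

open scoped ENNReal


/-! ### Integrals against conditional laws -/

section ConditionalLaw

variable {Ω T : Type*} {m mΩ : MeasurableSpace Ω} [mT : MeasurableSpace T]

/-- If `κ ω` is the conditional law of `τ` given `m`, tested on single events, then it also computes
the probability that `(ω, τ ω)` lies in a set that is jointly measurable for `m` and the target. As `κ`
need not be a kernel, its values on the sections are only almost surely equal to an `m`-measurable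
function `g`. -/
theorem measure_preimage_of_conditional_law (hm : m ≤ mΩ) (Pr : Measure Ω)
    [IsProbabilityMeasure Pr] (κ : Ω → Measure T) (hκ : ∀ ω, IsProbabilityMeasure (κ ω))
    {τ : Ω → T} (hτ : Measurable τ)
    (law : ∀ E, MeasurableSet E → Pr⟦τ ⁻¹' E | m⟧ =ᵐ[Pr] fun ω => (κ ω).real E)
    {W : Set (Ω × T)} (hW : MeasurableSet[m.prod mT] W) :
    ∃ g : Ω → ℝ≥0∞, Measurable[m] g ∧ (fun ω => κ ω (Prod.mk ω ⁻¹' W)) =ᵐ[Pr] g ∧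
      Pr ((fun ω => (ω, τ ω)) ⁻¹' W) = ∫⁻ ω, g ω ∂Pr := by
  have hpair : Measurable[mΩ, m.prod mT] (fun ω => (ω, τ ω)) :=
    @Measurable.prodMk Ω mΩ Ω T m mT _ _ (measurable_id'' hm) hτ
  have hsec : ∀ ω, Measurable[mT, m.prod mT] (Prod.mk ω : T → Ω × T) := fun ω =>
    @measurable_prodMk_left Ω T m mT ω
  induction W, hW using MeasurableSpace.induction_on_inter
    (h_eq := (@generateFrom_prod Ω T m mT).symm) (h_inter := @isPiSystem_prod Ω T m mT) with
  | empty => exact ⟨fun _ => 0, measurable_const, by simp, by simp⟩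
  | basic W hW =>
    obtain ⟨A, hA, E, hE, rfl⟩ := hW
    have hA' : MeasurableSet[m] A := hA
    refine ⟨A.indicator fun ω => ENNReal.ofReal ((Pr⟦τ ⁻¹' E | m⟧) ω), ?_, ?_, ?_⟩
    · exact (stronglyMeasurable_condExp.measurable.ennreal_ofReal).indicator hA'
    · filter_upwards [law E hE] with ω hω
      by_cases h : ω ∈ A
      · have : Prod.mk ω ⁻¹' (A ×ˢ E) = E := by ext; simp [h]
        rw [this, Set.indicator_of_mem h, hω, ofReal_measureReal]
      · have : Prod.mk ω ⁻¹' (A ×ˢ E) = ∅ := by ext; simp [h]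
        rw [this, Set.indicator_of_notMem h, measure_empty]
    · have hpre : (fun ω => (ω, τ ω)) ⁻¹' (A ×ˢ E) = A ∩ τ ⁻¹' E := by ext; simp
      have hnn : 0 ≤ᵐ[Pr.restrict A] (Pr⟦τ ⁻¹' E | m⟧) := by
        refine ae_restrict_of_ae ?_
        filter_upwards [law E hE] with ω hω
        rw [hω]; exact measureReal_nonneg
      have hint : Integrable ((τ ⁻¹' E).indicator fun _ => (1 : ℝ)) Pr :=
        (integrable_const _).indicator (hτ hE)
      rw [hpre, lintegral_indicator (hm _ hA'),
        ← ofReal_integral_eq_lintegral_ofReal integrable_condExp.integrableOn hnn,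
        setIntegral_condExp hm hint hA', setIntegral_indicator (hτ hE)]
      simp
  | compl W hW ih =>
    obtain ⟨g, hg, hae, hint⟩ := ih
    refine ⟨fun ω => 1 - g ω, measurable_const.sub hg, ?_, ?_⟩
    · filter_upwards [hae] with ω hω
      have := hκ ω
      rw [← hω, Set.preimage_compl, prob_compl_eq_one_sub (hsec ω hW)]
    · have hle : ∀ᵐ ω ∂Pr, g ω ≤ 1 := by
        filter_upwards [hae] with ω hω
        have := hκ ω
        rw [← hω]; exact prob_le_one
      have hfin : ∫⁻ ω, g ω ∂Pr ≠ ∞ := by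
        rw [← hint]; exact measure_ne_top _ _
      rw [Set.preimage_compl, prob_compl_eq_one_sub (hpair hW), hint,
        lintegral_sub (hg.mono hm le_rfl) hfin hle]
      simp
  | iUnion f hd hf ih =>
    choose g hg hae hint using ih
    refine ⟨fun ω => ∑' i, g i ω, ?_, ?_, ?_⟩
    · simp_rw [ENNReal.tsum_eq_iSup_sum]
      exact Measurable.iSup fun s => Finset.measurable_fun_sum s fun i _ => hg i
    · filter_upwards [ae_all_iff.2 hae] with ω hω
      rw [Set.preimage_iUnion, measure_iUnion _ (fun i => hsec ω (hf i))]
      · exact tsum_congr hω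
      · exact fun i j hij => (hd hij).preimage _
    · rw [Set.preimage_iUnion, measure_iUnion _ (fun i => hpair (hf i)),
        lintegral_tsum fun i => ((hg i).mono hm le_rfl).aemeasurable]
      · exact tsum_congr hint
      · exact fun i j hij => (hd hij).preimage _

/-- The disintegration formula `E Φ(·, τ) = E ∫ Φ(·, t) κ(dt)` for a conditional law `κ` given `m` and
a function `Φ` whose first argument is `m`-measurable; `g` is an `m`-measurable version of the inner
integral. -/
theorem lintegral_of_conditional_law (hm : m ≤ mΩ) (Pr : Measure Ω)
    [IsProbabilityMeasure Pr] (κ : Ω → Measure T) (hκ : ∀ ω, IsProbabilityMeasure (κ ω))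
    {τ : Ω → T} (hτ : Measurable τ)
    (law : ∀ E, MeasurableSet E → Pr⟦τ ⁻¹' E | m⟧ =ᵐ[Pr] fun ω => (κ ω).real E)
    {Φ : Ω × T → ℝ≥0∞} (hΦ : Measurable[m.prod mT] Φ) :
    ∃ g : Ω → ℝ≥0∞, Measurable[m] g ∧ (fun ω => ∫⁻ t, Φ (ω, t) ∂κ ω) =ᵐ[Pr] g ∧
      ∫⁻ ω, Φ (ω, τ ω) ∂Pr = ∫⁻ ω, g ω ∂Pr := by
  have hpair : Measurable[mΩ, m.prod mT] (fun ω => (ω, τ ω)) :=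
    @Measurable.prodMk Ω mΩ Ω T m mT _ _ (measurable_id'' hm) hτ
  have hsec : ∀ ω, Measurable[mT, m.prod mT] (Prod.mk ω : T → Ω × T) := fun ω =>
    @measurable_prodMk_left Ω T m mT ω
  refine @Measurable.ennreal_induction (Ω × T) (m.prod mT) (fun Φ => ∃ g : Ω → ℝ≥0∞,
    Measurable[m] g ∧ (fun ω => ∫⁻ t, Φ (ω, t) ∂κ ω) =ᵐ[Pr] g ∧
      ∫⁻ ω, Φ (ω, τ ω) ∂Pr = ∫⁻ ω, g ω ∂Pr) ?_ ?_ ?_ Φ hΦ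
  · intro c W hW
    obtain ⟨g, hg, hae, hint⟩ := measure_preimage_of_conditional_law hm Pr κ hκ hτ law hW
    refine ⟨fun ω => c * g ω, hg.const_mul c, ?_, ?_⟩
    · filter_upwards [hae] with ω hω
      rw [← hω]
      exact lintegral_indicator_const (hsec ω hW) c
    · rw [lintegral_const_mul c (hg.mono hm le_rfl), ← hint]
      exact lintegral_indicator_const (hpair hW) c
  · intro u v _ hu hv ⟨g, hg, hae, hint⟩ ⟨g', hg', hae', hint'⟩
    refine ⟨fun ω => g ω + g' ω, hg.add hg', ?_, ?_⟩
    · filter_upwards [hae, hae'] with ω h1 h2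
      rw [← h1, ← h2]
      exact lintegral_add_left (hu.comp (hsec ω)) _
    · rw [lintegral_add_left (hg.mono hm le_rfl), ← hint, ← hint']
      exact lintegral_add_left (hu.comp hpair) _
  · intro u hu hmono ih
    choose g hg hae hint using ih
    have hgmono : ∀ᵐ ω ∂Pr, Monotone fun n => g n ω := by
      filter_upwards [ae_all_iff.2 hae] with ω hω i j hij
      simp only
      rw [← hω i, ← hω j]
      exact lintegral_mono fun t => hmono hij _
    refine ⟨fun ω => ⨆ n, g n ω, Measurable.iSup hg, ?_, ?_⟩
    · filter_upwards [ae_all_iff.2 hae] with ω hω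
      rw [lintegral_iSup (f := fun n t => u n (ω, t)) (fun n => (hu n).comp (hsec ω)) fun i j hij t => hmono hij _]
      exact iSup_congr hω
    · rw [lintegral_iSup' (f := g) (fun n => ((hg n).mono hm le_rfl).aemeasurable) hgmono]
      rw [lintegral_iSup (f := fun n ω => u n (ω, τ ω)) (fun n => (hu n).comp hpair) fun i j hij t => hmono hij _]
      exact iSup_congr hint

end ConditionalLaw

/-! ### Exponential supermartingales -/

section Concentration

variable {Ω T : Type*} {mΩ : MeasurableSpace Ω} [mT : MeasurableSpace T]

/-- Chernoff bound for an exponential supermartingale: if `exp (z i)` has conditional mean at most `1`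
for all `i`, then the sum of the `z i` exceeds `b` with probability at most `exp (-b)`. The increment
`z i` may depend on the past and on the `i`-th observation. -/
theorem measure_lt_sum_of_lintegral_exp_le_one {Pr : Measure Ω} [IsProbabilityMeasure Pr]
    {ℱ : Filtration ℕ mΩ} {n : ℕ} {κ : ℕ → Ω → Measure T}
    (hκ : ∀ i ω, IsProbabilityMeasure (κ i ω)) {τ : ℕ → Ω → T}
    (hτ : ∀ i ∈ Finset.Icc 1 n, Measurable[ℱ i] (τ i))
    (law : ∀ i ∈ Finset.Icc 1 n, ∀ E, MeasurableSet E →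
      Pr⟦τ i ⁻¹' E | ℱ (i - 1)⟧ =ᵐ[Pr] fun ω => (κ i ω).real E)
    {z : ℕ → Ω × T → ℝ} (hz : ∀ i ∈ Finset.Icc 1 n, Measurable[(ℱ (i - 1)).prod mT] (z i))
    (hle : ∀ i ∈ Finset.Icc 1 n, ∀ᵐ ω ∂Pr,
      ∫⁻ t, ENNReal.ofReal (Real.exp (z i (ω, t))) ∂κ i ω ≤ 1) (b : ℝ) :
    Pr {ω | b < ∑ i ∈ Finset.Icc 1 n, z i (ω, τ i ω)} ≤ ENNReal.ofReal (Real.exp (-b)) := by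
  set Y : ℕ → Ω → ℝ≥0∞ := fun i ω => ENNReal.ofReal (Real.exp (z i (ω, τ i ω))) with hYdef
  have hY : ∀ i ∈ Finset.Icc 1 n, Measurable[ℱ i] (Y i) := by
    intro i hi
    have hpair : Measurable[ℱ i, (ℱ (i - 1)).prod mT] (fun ω => (ω, τ i ω)) :=
      @Measurable.prodMk Ω (ℱ i) Ω T (ℱ (i - 1)) mT _ _
        (measurable_id'' (ℱ.mono (Nat.sub_le i 1))) (hτ i hi)
    exact (Real.measurable_exp.comp ((hz i hi).comp hpair)).ennreal_ofReal
  have hprod : ∀ k ≤ n, Measurable[ℱ k] (fun ω => ∏ i ∈ Finset.Icc 1 k, Y i ω) := fun k hk =>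
    Finset.measurable_prod _ fun i hi =>
      (hY i (Finset.Icc_subset_Icc_right hk hi)).mono (ℱ.mono (Finset.mem_Icc.1 hi).2) le_rfl
  have key : ∀ k ≤ n, ∫⁻ ω, ∏ i ∈ Finset.Icc 1 k, Y i ω ∂Pr ≤ 1 := by
    intro k
    induction k with
    | zero => intro _; simp
    | succ k ih =>
      intro hk
      have hmem : k + 1 ∈ Finset.Icc 1 n := Finset.mem_Icc.2 ⟨by omega, hk⟩
      have hsec : ∀ ω, Measurable[mT, (ℱ k).prod mT] (Prod.mk ω : T → Ω × T) := fun ω =>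
        @measurable_prodMk_left Ω T (ℱ k) mT ω
      have hz' : Measurable[(ℱ k).prod mT]
          (fun q : Ω × T => ENNReal.ofReal (Real.exp (z (k + 1) q))) :=
        (Real.measurable_exp.comp (hz (k + 1) hmem)).ennreal_ofReal
      have hΦ : Measurable[(ℱ k).prod mT] (fun q : Ω × T =>
          (∏ i ∈ Finset.Icc 1 k, Y i q.1) * ENNReal.ofReal (Real.exp (z (k + 1) q))) :=
        ((hprod k (by omega)).comp (@measurable_fst Ω T (ℱ k) mT)).mul hz'
      obtain ⟨g, hg, hae, hint⟩ := lintegral_of_conditional_law (ℱ.le k) Pr (κ (k + 1))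
        (hκ (k + 1)) ((hτ _ hmem).mono (ℱ.le _) le_rfl) (law (k + 1) hmem) hΦ
      calc ∫⁻ ω, ∏ i ∈ Finset.Icc 1 (k + 1), Y i ω ∂Pr
          = ∫⁻ ω, g ω ∂Pr := by
            rw [← hint]
            refine lintegral_congr fun ω => ?_
            rw [Finset.prod_Icc_succ_top (by omega)]
        _ ≤ ∫⁻ ω, ∏ i ∈ Finset.Icc 1 k, Y i ω ∂Pr := by
            refine lintegral_mono_ae ?_
            filter_upwards [hae, hle (k + 1) hmem] with ω h1 h2
            rw [← h1]
            exact (lintegral_const_mul _ (hz'.comp (hsec ω))).trans_le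
              (mul_le_of_le_one_right' h2)
        _ ≤ 1 := ih (by omega)
  have hsub : {ω | b < ∑ i ∈ Finset.Icc 1 n, z i (ω, τ i ω)} ⊆
      {ω | ENNReal.ofReal (Real.exp b) ≤ ∏ i ∈ Finset.Icc 1 n, Y i ω} := by
    intro ω hω
    have hω' : b < ∑ i ∈ Finset.Icc 1 n, z i (ω, τ i ω) := hω
    change ENNReal.ofReal (Real.exp b) ≤ ∏ i ∈ Finset.Icc 1 n, Y i ω
    simp only [hYdef]
    rw [← ENNReal.ofReal_prod_of_nonneg fun i _ => (Real.exp_pos _).le, ← Real.exp_sum]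
    exact ENNReal.ofReal_le_ofReal (Real.exp_le_exp.2 hω'.le)
  refine (measure_mono hsub).trans ?_
  have hpos : ENNReal.ofReal (Real.exp b) ≠ 0 := by simp [Real.exp_pos]
  refine (meas_ge_le_lintegral_div ((hprod n le_rfl).mono (ℱ.le n) le_rfl).aemeasurable hpos
    ENNReal.ofReal_ne_top).trans ?_
  rw [Real.exp_neg, ENNReal.ofReal_inv_of_pos (Real.exp_pos _), div_eq_mul_inv]
  exact mul_le_of_le_one_left' (key n le_rfl)

/-- The sum of the conditional means of variables with values in `[0, r]` is at most twice the sum of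
the variables, up to a deviation `2 r b`. This follows from `exp (-u) ≤ 1 - u / 2` on `[0, 1]`. -/
theorem measure_lt_sum_integral {Pr : Measure Ω} [IsProbabilityMeasure Pr]
    {ℱ : Filtration ℕ mΩ} {n : ℕ} {κ : ℕ → Ω → Measure T}
    (hκ : ∀ i ω, IsProbabilityMeasure (κ i ω)) {τ : ℕ → Ω → T}
    (hτ : ∀ i ∈ Finset.Icc 1 n, Measurable[ℱ i] (τ i))
    (law : ∀ i ∈ Finset.Icc 1 n, ∀ E, MeasurableSet E →
      Pr⟦τ i ⁻¹' E | ℱ (i - 1)⟧ =ᵐ[Pr] fun ω => (κ i ω).real E)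
    {x : ℕ → Ω × T → ℝ} (hx : ∀ i ∈ Finset.Icc 1 n, Measurable[(ℱ (i - 1)).prod mT] (x i))
    {r : ℝ} (hr0 : 0 ≤ r) (hx0 : ∀ i q, 0 ≤ x i q) (hxr : ∀ i q, x i q ≤ r) (b : ℝ) :
    Pr {ω | 2 * ∑ i ∈ Finset.Icc 1 n, x i (ω, τ i ω) + 2 * r * b <
      ∑ i ∈ Finset.Icc 1 n, ∫ t, x i (ω, t) ∂κ i ω} ≤ ENNReal.ofReal (Real.exp (-b)) := by
  rcases hr0.eq_or_lt with rfl | hr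
  · have hx' : ∀ i q, x i q = 0 := fun i q => le_antisymm (hxr i q) (hx0 i q)
    simp [hx']
  have hsec : ∀ i ω, Measurable[mT, (ℱ (i - 1)).prod mT] (Prod.mk ω : T → Ω × T) := fun i ω =>
    @measurable_prodMk_left Ω T (ℱ (i - 1)) mT ω
  have hexp : ∀ u : ℝ, 0 ≤ u → u ≤ 1 → Real.exp (-u) ≤ 1 - u / 2 := by
    intro u h0 h1
    have h2 := Real.exp_bound' (x := u) h0 h1 (n := 1) one_pos
    have h3 := Real.add_one_le_exp u
    rw [Real.exp_neg]
    refine (inv_anti₀ (by linarith) h3).trans ?_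
    rw [inv_le_iff_one_le_mul₀ (by linarith)]
    nlinarith
  -- The conditional means agree almost surely with functions measurable for the past.
  have hver : ∀ i, ∃ e : Ω → ℝ, i ∈ Finset.Icc 1 n → Measurable[ℱ (i - 1)] e ∧
      ∀ᵐ ω ∂Pr, ∫ t, x i (ω, t) ∂κ i ω = e ω := by
    intro i
    by_cases hi : i ∈ Finset.Icc 1 n
    · obtain ⟨g, hg, hae, -⟩ := lintegral_of_conditional_law (ℱ.le (i - 1)) Pr (κ i) (hκ i)
        ((hτ i hi).mono (ℱ.le i) le_rfl) (law i hi) (hx i hi).ennreal_ofReal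
      refine ⟨fun ω => (g ω).toReal, fun _ => ⟨hg.ennreal_toReal, ?_⟩⟩
      filter_upwards [hae] with ω hω
      rw [integral_eq_lintegral_of_nonneg_ae (Filter.Eventually.of_forall fun t => hx0 i _)
        ((hx i hi).comp (hsec i ω)).aestronglyMeasurable, ← hω]
    · exact ⟨0, fun h => absurd h hi⟩
  choose e he using hver
  have hmain := measure_lt_sum_of_lintegral_exp_le_one hκ hτ law
    (z := fun i q => (e i q.1 / 2 - x i q) / r)
    (fun i hi => ((((he i hi).1.comp (@measurable_fst Ω T (ℱ (i - 1)) mT)).div_const 2).sub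
      (hx i hi)).div_const r) ?_ b
  · have haeq : ∀ᵐ ω ∂Pr, ∀ i ∈ Finset.Icc 1 n, ∫ t, x i (ω, t) ∂κ i ω = e i ω :=
      (Finset.eventually_all _).2 fun i hi => (he i hi).2
    refine (measure_mono_ae ?_).trans hmain
    filter_upwards [haeq] with ω hω h
    change _ < _ at h
    change _ < _
    rw [Finset.sum_congr rfl hω] at h
    rw [← Finset.sum_div, lt_div_iff₀ hr, Finset.sum_sub_distrib, ← Finset.sum_div]
    linarith
  · intro i hi
    filter_upwards [(he i hi).2] with ω hω
    have := hκ i ω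
    have hm : Measurable fun t => x i (ω, t) := (hx i hi).comp (hsec i ω)
    have hint : Integrable (fun t => x i (ω, t)) (κ i ω) :=
      Integrable.of_mem_Icc 0 r hm.aemeasurable
        (Filter.Eventually.of_forall fun t => ⟨hx0 i _, hxr i _⟩)
    have hpt : ∀ t, Real.exp ((e i ω / 2 - x i (ω, t)) / r) ≤
        Real.exp (e i ω / 2 / r) * (1 - x i (ω, t) / r / 2) := by
      intro t
      rw [sub_div, sub_eq_add_neg, Real.exp_add]
      gcongr
      exact hexp _ (div_nonneg (hx0 i _) hr.le) ((div_le_one hr).2 (hxr i _))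
    have hint' : Integrable (fun t => Real.exp (e i ω / 2 / r) * (1 - x i (ω, t) / r / 2))
        (κ i ω) :=
      ((integrable_const _).sub ((hint.div_const r).div_const 2)).const_mul _
    calc ∫⁻ t, ENNReal.ofReal (Real.exp ((e i ω / 2 - x i (ω, t)) / r)) ∂κ i ω
        ≤ ∫⁻ t, ENNReal.ofReal (Real.exp (e i ω / 2 / r) * (1 - x i (ω, t) / r / 2)) ∂κ i ω :=
          lintegral_mono fun t => ENNReal.ofReal_le_ofReal (hpt t)
      _ = ENNReal.ofReal (∫ t, Real.exp (e i ω / 2 / r) * (1 - x i (ω, t) / r / 2) ∂κ i ω) :=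
          (ofReal_integral_eq_lintegral_ofReal hint'
            (Filter.Eventually.of_forall fun t => (Real.exp_pos _).le.trans (hpt t))).symm
      _ ≤ 1 := by
          rw [← ENNReal.ofReal_one]
          refine ENNReal.ofReal_le_ofReal ?_
          rw [integral_const_mul, integral_sub (integrable_const _)
            ((hint.div_const r).div_const 2), integral_div, integral_div, hω]
          simp only [integral_const, probReal_univ, smul_eq_mul, mul_one]
          have h1 := Real.add_one_le_exp (-(e i ω / 2 / r))
          have h2 : 1 - e i ω / r / 2 ≤ Real.exp (-(e i ω / 2 / r)) := by
            have : e i ω / r / 2 = e i ω / 2 / r := by ring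
            linarith
          calc Real.exp (e i ω / 2 / r) * (1 - e i ω / r / 2)
              ≤ Real.exp (e i ω / 2 / r) * Real.exp (-(e i ω / 2 / r)) := by gcongr
            _ = 1 := by rw [← Real.exp_add]; simp

end Concentration

/-! ### Trajectories of the game -/

section Rollout

variable {S A B : Type*} [MeasurableSpace S] [MeasurableSpace A] [MeasurableSpace B] {H : ℕ}

theorem measurable_trajectory_cons (n : ℕ) :
    Measurable fun p : ((S × A × B) × S) × Trajectory S A B n =>
      (Fin.cons p.1 p.2 : Trajectory S A B (n + 1)) := by
  refine measurable_pi_iff.2 fun j => ?_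
  refine Fin.cases ?_ (fun j => ?_) j
  · simpa using measurable_fst
  · simp only [Fin.cons_succ]
    exact (measurable_pi_apply j).comp measurable_snd

instance MarkovGame.isMarkovKernel_stepKernel (M : MarkovGame S A B H) (υ : MarkovPolicy S A)
    (μ : MarkovPolicy S B) (h : ℕ) : IsMarkovKernel (M.stepKernel υ μ h) := by
  have := M.markov_trans h
  have := υ.markov_act h
  have := μ.markov_act h
  unfold MarkovGame.stepKernel
  infer_instance

instance MarkovGame.isMarkovKernel_rollout (M : MarkovGame S A B H) (υ : MarkovPolicy S A)
    (μ : MarkovPolicy S B) (n h : ℕ) : IsMarkovKernel (M.rollout υ μ n h) := by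
  induction n generalizing h with
  | zero => unfold MarkovGame.rollout; infer_instance
  | succ n ih =>
    have := ih (h + 1)
    unfold MarkovGame.rollout
    exact Kernel.IsMarkovKernel.map _ (measurable_trajectory_cons n)

/-- An integral bound conditional on the state and the actions holds for the whole step. -/
theorem MarkovGame.lintegral_stepKernel_le_one (M : MarkovGame S A B H) (υ : MarkovPolicy S A)
    (μ : MarkovPolicy S B) (h : ℕ) {ψ : (S × A × B) × S → ℝ≥0∞} (hψ : Measurable ψ)
    (hle : ∀ η, ∫⁻ ζ, ψ (η, ζ) ∂M.trans h η ≤ 1) (s : S) :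
    ∫⁻ p, ψ p ∂M.stepKernel υ μ h s ≤ 1 := by
  have := M.markov_trans h
  have := υ.markov_act h
  have := μ.markov_act h
  unfold MarkovGame.stepKernel
  rw [Kernel.lintegral_compProd _ _ _ hψ]
  simp only [Kernel.prodMkLeft_apply]
  exact (lintegral_mono fun η => hle η).trans (by simp)

/-- Within an episode, the next state `ζ` of step `h + j` is drawn from the transition kernel given
`η`; hence a bound on the integrals over `ζ` for fixed `η` holds under the law of the episode. -/
theorem MarkovGame.lintegral_rollout_le_one (M : MarkovGame S A B H) (υ : MarkovPolicy S A)
    (μ : MarkovPolicy S B) {n : ℕ} (h : ℕ) (j : Fin n) {ψ : (S × A × B) × S → ℝ≥0∞}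
    (hψ : Measurable ψ) (hle : ∀ η, ∫⁻ ζ, ψ (η, ζ) ∂M.trans (h + j) η ≤ 1) (s : S) :
    ∫⁻ t, ψ (t j) ∂M.rollout υ μ n h s ≤ 1 := by
  induction n generalizing h s with
  | zero => exact j.elim0
  | succ n ih =>
    have hm : Measurable fun t : Trajectory S A B (n + 1) => ψ (t j) :=
      hψ.comp (measurable_pi_apply j)
    have hm' : Measurable fun p : ((S × A × B) × S) × Trajectory S A B n =>
        ψ ((Fin.cons p.1 p.2 : Trajectory S A B (n + 1)) j) :=
      hm.comp (measurable_trajectory_cons n)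
    unfold MarkovGame.rollout
    rw [Kernel.lintegral_map _ (measurable_trajectory_cons n) _ hm,
      Kernel.lintegral_compProd _ _ _ hm']
    simp only [Kernel.prodMkLeft_apply]
    induction j using Fin.cases with
    | zero =>
      simp only [Fin.cons_zero, lintegral_const, measure_univ, mul_one]
      exact M.lintegral_stepKernel_le_one υ μ h hψ (by simpa using hle) s
    | succ j =>
      simp only [Fin.cons_succ]
      have hle' : ∀ η, ∫⁻ ζ, ψ (η, ζ) ∂M.trans (h + 1 + j) η ≤ 1 := by
        intro η
        have := hle η
        rwa [Fin.val_succ, show h + ((j : ℕ) + 1) = h + 1 + j by ring] at this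
      calc _ ≤ ∫⁻ _, 1 ∂M.stepKernel υ μ h s :=
            lintegral_mono fun p => ih (h + 1) j hle' p.2
        _ = 1 := by simp

end Rollout

/-! ### Hoeffding's lemma for the drop of a squared loss -/

section Hoeffding

variable {X E : Type*} [MeasurableSpace X] [NormedAddCommGroup E] [InnerProductSpace ℝ E]
  [CompleteSpace E]

open scoped InnerProductSpace in
/-- For a random vector `Y` of mean `v` with `‖Y‖ ≤ R`, the drop `2⟪v, Y⟫ - ‖v‖²` of the squared norm
has mean `‖v‖²`, and at the parameter `1 / (4R²)` its fluctuation costs only half of this mean. -/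
theorem lintegral_exp_excess_le_one {P : Measure X} [IsProbabilityMeasure P] {Y : X → E}
    (hY : AEStronglyMeasurable Y P) {R : ℝ} (hR : 0 < R) (hYR : ∀ x, ‖Y x‖ ≤ R) {v : E}
    (hv : ∫ x, Y x ∂P = v) :
    ∫⁻ x, ENNReal.ofReal (Real.exp ((‖v‖ ^ 2 / 2 - (2 * ⟪v, Y x⟫_ℝ - ‖v‖ ^ 2)) / (4 * R ^ 2))) ∂P
      ≤ 1 := by
  have hm : AEStronglyMeasurable (fun x => ⟪v, Y x⟫_ℝ) P := aestronglyMeasurable_const.inner hY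
  have hb : ∀ᵐ x ∂P, ⟪v, Y x⟫_ℝ ∈ Set.Icc (-(R * ‖v‖)) (R * ‖v‖) := by
    refine Filter.Eventually.of_forall fun x => abs_le.1 ?_
    refine (abs_real_inner_le_norm _ _).trans ?_
    rw [mul_comm]
    exact mul_le_mul_of_nonneg_right (hYR x) (norm_nonneg _)
  have hYint : Integrable Y P := Integrable.of_bound hY R (Filter.Eventually.of_forall hYR)
  have hmean : ∫ x, ⟪v, Y x⟫_ℝ ∂P = ‖v‖ ^ 2 := by
    rw [integral_inner hYint, hv, real_inner_self_eq_norm_sq]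
  have hsub := hasSubgaussianMGF_of_mem_Icc hm.aemeasurable hb
  rw [hmean] at hsub
  have hmgf := hsub.mgf_le (-(1 / (2 * R ^ 2)))
  have hint := hsub.integrable_exp_mul (-(1 / (2 * R ^ 2)))
  have hval : ((‖R * ‖v‖ - -(R * ‖v‖)‖₊ / 2 : NNReal) : ℝ) = R * ‖v‖ := by
    have : 0 ≤ R * ‖v‖ := by positivity
    simp only [NNReal.coe_div, coe_nnnorm, Real.norm_eq_abs, NNReal.coe_ofNat]
    rw [abs_of_nonneg (by linarith)]
    ring
  have hexp : ∀ x, Real.exp ((‖v‖ ^ 2 / 2 - (2 * ⟪v, Y x⟫_ℝ - ‖v‖ ^ 2)) / (4 * R ^ 2)) =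
      Real.exp (-(‖v‖ ^ 2 / (8 * R ^ 2))) *
        Real.exp (-(1 / (2 * R ^ 2)) * (⟪v, Y x⟫_ℝ - ‖v‖ ^ 2)) := by
    intro x
    rw [← Real.exp_add]
    congr 1
    field_simp
    ring
  simp_rw [hexp]
  rw [← ofReal_integral_eq_lintegral_ofReal (hint.const_mul _)
    (Filter.Eventually.of_forall fun x => by positivity), integral_const_mul, ← ENNReal.ofReal_one]
  refine ENNReal.ofReal_le_ofReal ?_
  calc Real.exp (-(‖v‖ ^ 2 / (8 * R ^ 2))) *
        ∫ x, Real.exp (-(1 / (2 * R ^ 2)) * (⟪v, Y x⟫_ℝ - ‖v‖ ^ 2)) ∂P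
      ≤ Real.exp (-(‖v‖ ^ 2 / (8 * R ^ 2))) * Real.exp (‖v‖ ^ 2 / (8 * R ^ 2)) := by
        gcongr
        refine hmgf.trans (le_of_eq ?_)
        push_cast at hval ⊢
        rw [hval]
        congr 1
        field_simp
        ring
    _ = 1 := by rw [← Real.exp_add]; simp

end Hoeffding

/-! ### The update grid and the confidence sets -/

section Grid

open Classical in
/-- The last episode `≤ k` after which the confidence set was recomputed, and `0` if there is none. -/
noncomputable def lastUpdate (m o : ℕ) : ℕ → ℕ
  | 0 => 0
  | k + 1 => if IsUpdate m o (k + 1) then k + 1 else lastUpdate m o k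

variable {m o : ℕ}

open Classical in
theorem lastUpdate_succ (m o k : ℕ) :
    lastUpdate m o (k + 1) = if IsUpdate m o (k + 1) then k + 1 else lastUpdate m o k := rfl

theorem lastUpdate_le (m o k : ℕ) : lastUpdate m o k ≤ k := by
  induction k with
  | zero => simp [lastUpdate]
  | succ k ih => unfold lastUpdate; split_ifs <;> omega

theorem le_lastUpdate {u k : ℕ} (hu : IsUpdate m o u) (huk : u ≤ k) : u ≤ lastUpdate m o k := by
  induction k with
  | zero => omega
  | succ k ih =>
    unfold lastUpdate
    split_ifs with h
    · exact huk
    · refine ih (Nat.lt_succ_iff.1 (lt_of_le_of_ne huk ?_))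
      rintro rfl
      exact h hu

/-- A batch has at most `m` episodes. -/
theorem lt_lastUpdate_add (hm : 1 ≤ m) (ho : o ≤ 1) (k : ℕ) : k < lastUpdate m o k + m := by
  rcases Nat.eq_zero_or_pos k with rfl | hk
  · omega
  have hu : IsUpdate m o ((k - o) / m * m + o) := ⟨_, rfl⟩
  have h1 := Nat.div_add_mod (k - o) m
  have h2 := Nat.mod_lt (k - o) hm
  rw [mul_comm] at h1
  have := le_lastUpdate hu (k := k) (by omega)
  omega

/-- Episodes `i + 1 ≤ k + 1` with `i` not before the last update belong to the same batch. -/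
theorem lastUpdate_eq_of_lt {i k : ℕ} (hik : i ≤ k) (h : lastUpdate m o k ≤ i) :
    lastUpdate m o i = lastUpdate m o k := by
  induction k with
  | zero => simp [Nat.le_zero.1 hik]
  | succ k ih =>
    rcases Nat.lt_or_ge i (k + 1) with hlt | hge
    · rw [lastUpdate_succ] at h ⊢
      split_ifs at h ⊢ with hu
      · omega
      · exact ih (by omega) h
    · rw [le_antisymm hik hge]

/-- The hypothesis is constant on a batch. -/
theorem eq_of_lastUpdate_lt {α : Type*} {f : ℕ → α} {K : ℕ}
    (keep : ∀ k ∈ Finset.Icc 1 K, k + 1 ≤ K → ¬ IsUpdate m o k → f (k + 1) = f k)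
    {i k : ℕ} (hkK : k + 1 ≤ K) (hik : i ≤ k) (h : lastUpdate m o k ≤ i) :
    f (k + 1) = f (i + 1) := by
  induction k with
  | zero => simp [Nat.le_zero.1 hik]
  | succ k ih =>
    rcases Nat.lt_or_ge i (k + 1) with hlt | hge
    · unfold lastUpdate at h
      split_ifs at h with hu
      · omega
      · rw [keep (k + 1) (Finset.mem_Icc.2 ⟨by omega, by omega⟩) hkK hu]
        exact ih (by omega) (by omega) h
    · rw [le_antisymm hik hge]

end Grid

section ConfidenceSet

variable {S A B G : Type*} {F : Set G} {H p : ℕ}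

/-- The confidence set after episode `k` is the one computed at the last update. Without any update,
the defining condition is about empty sums and holds for all hypotheses. -/
theorem mem_confidenceSet_iff (ℓ : LossFunction S A B F H p) {β : ℝ} (hβ : 0 ≤ β) (m o : ℕ)
    (fs : ℕ → F) (τs : ℕ → Trajectory S A B H) (k : ℕ) (f : F) :
    f ∈ confidenceSet ℓ β m o fs τs k ↔ ∀ h, empLoss ℓ fs τs h (lastUpdate m o k) f f -
      ⨅ g : G, empLoss ℓ fs τs h (lastUpdate m o k) f g ≤ β := by
  induction k with
  | zero =>
    have : Nonempty G := ⟨f⟩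
    simp [confidenceSet, lastUpdate, empLoss, hβ]
  | succ k ih =>
    unfold confidenceSet lastUpdate
    split_ifs with hu
    · rfl
    · exact ih

theorem bddBelow_empLoss (ℓ : LossFunction S A B F H p) (fs : ℕ → F)
    (τs : ℕ → Trajectory S A B H) (h : Fin H) (k : ℕ) (f : F) :
    BddBelow (Set.range fun g : G => empLoss ℓ fs τs h k f g) := by
  refine ⟨0, ?_⟩
  rintro _ ⟨g, rfl⟩
  exact Finset.sum_nonneg fun i _ => sq_nonneg _

end ConfidenceSet

/-! ### The eluder condition -/

section Eluder

variable {S A B G : Type*} [MeasurableSpace S] [MeasurableSpace A] [MeasurableSpace B]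
  {F : Set G} {H p : ℕ} {M : MarkovGame S A B H} {ℓ : LossFunction S A B F H p}

/-- As `T` fixes `fstar`, decomposability says that `fstar` has mean loss zero. -/
theorem meanLoss_fstar {fstar : F} (hT : IsDecomposable M ℓ fstar) (h : Fin H) (f' : F)
    (η : S × A × B) (ζ : S) : meanLoss M ℓ h f' η fstar fstar = 0 := by
  obtain ⟨T, hTs, hdec⟩ := hT
  have := hdec h f' ζ η fstar fstar
  rw [hTs] at this
  exact sub_eq_self.1 this

/-- The eluder condition along a set `P` of episodes: enumerate `P` increasingly, and fill the sequence
up with `fstar`, whose mean loss vanishes. -/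
theorem L2EluderCondition.sum_le {R Cel d : ℝ} {K : ℕ} {fstar : F}
    (hel : L2EluderCondition M ℓ R Cel d K) (hT : IsDecomposable M ℓ fstar) {β : ℝ}
    (hβ0 : 0 ≤ β)
    (hβ : R ^ 2 ≤ β) (h : Fin H) (f : ℕ → F) (η : ℕ → S × A × B) {P : Finset ℕ}
    (hPK : P.card ≤ K)
    (hP : ∀ k ∈ P, ∑ i ∈ P with i < k, ‖meanLoss M ℓ h (f i) (η i) (f k) (f k)‖ ^ 2 ≤ β) :
    ∑ i ∈ P, ‖meanLoss M ℓ h (f i) (η i) (f i) (f i)‖ ^ 2 ≤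
      Cel * (d * β * Real.log (P.card + 1)) := by
  classical
  rcases P.eq_empty_or_nonempty with rfl | hne
  · simp
  set n := P.card with hn
  have hn1 : 1 ≤ n := hne.card_pos
  have hfin : (Set.ofPred (· ∈ P)).Finite := P.finite_toSet
  have hcard : hfin.toFinset.card = n := by
    rw [hn]; congr 1; ext; simp
  have hlt : ∀ {j}, j < n → ∀ hf : (Set.ofPred (· ∈ P)).Finite, j < hf.toFinset.card :=
    fun hj hf => hcard.symm ▸ hj
  -- The `j`-th element of `P`, counted from `1`.
  set e : ℕ → ℕ := fun j => Nat.nth (· ∈ P) (j - 1) with he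
  have hmem : ∀ j ∈ Finset.Icc 1 n, e j ∈ P := fun j hj => by
    have := Finset.mem_Icc.1 hj
    exact Nat.nth_mem (p := (· ∈ P)) (j - 1) (hlt (by omega))
  have hmono : ∀ i ∈ Finset.Icc 1 n, ∀ j ∈ Finset.Icc 1 n, i < j → e i < e j := fun i hi j hj hij => by
    have := Finset.mem_Icc.1 hi
    have := Finset.mem_Icc.1 hj
    exact Nat.nth_lt_nth_of_lt_card (p := (· ∈ P)) hfin (by omega) (hlt (by omega) hfin)
  have hinj : ∀ i ∈ Finset.Icc 1 n, ∀ j ∈ Finset.Icc 1 n, e i = e j → i = j := by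
    intro i hi j hj hij
    by_contra hne'
    rcases Nat.lt_or_gt_of_ne hne' with hlt' | hlt'
    · exact absurd hij (hmono i hi j hj hlt').ne
    · exact absurd hij (hmono j hj i hi hlt').ne'
  have himage : (Finset.Icc 1 n).image e = P := by
    refine Finset.eq_of_subset_of_card_le (Finset.image_subset_iff.2 hmem) ?_
    rw [Finset.card_image_of_injOn fun i hi j hj => hinj i hi j hj]
    simp [hn]
  let f' : ℕ → F := fun j => if j ≤ n then f (e j) else fstar
  have hf' : ∀ j ∈ Finset.Icc 1 n, f' j = f (e j) := fun j hj => if_pos (Finset.mem_Icc.1 hj).2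
  have hmain := hel β hβ h f' (fun j => η (e j)) ?_ n (Finset.mem_Icc.2 ⟨hn1, hPK⟩)
  · refine le_trans (le_of_eq ?_) hmain
    conv_lhs => rw [← himage]
    rw [Finset.sum_image fun i hi j hj => hinj i hi j hj]
    exact Finset.sum_congr rfl fun j hj => by rw [hf' j hj]
  · intro k hk
    by_cases hkn : k ≤ n
    · have hk' : k ∈ Finset.Icc 1 n := Finset.mem_Icc.2 ⟨(Finset.mem_Icc.1 hk).1, hkn⟩
      have hsub : Finset.Ico 1 k ⊆ Finset.Icc 1 n := fun i hi => by
        have := Finset.mem_Ico.1 hi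
        exact Finset.mem_Icc.2 ⟨this.1, by omega⟩
      refine le_trans ?_ (hP (e k) (hmem k hk'))
      rw [hf' k hk']
      have hsum : ∑ i ∈ Finset.Ico 1 k,
          ‖meanLoss M ℓ h (f' i) (η (e i)) (f (e k)) (f (e k))‖ ^ 2 =
          ∑ i ∈ (Finset.Ico 1 k).image e,
            ‖meanLoss M ℓ h (f i) (η i) (f (e k)) (f (e k))‖ ^ 2 := by
        rw [Finset.sum_image fun i hi j hj => hinj i (hsub hi) j (hsub hj)]
        exact Finset.sum_congr rfl fun j hj => by rw [hf' j (hsub hj)]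
      rw [hsum]
      refine Finset.sum_le_sum_of_subset_of_nonneg ?_ fun _ _ _ => sq_nonneg _
      intro a ha
      obtain ⟨i, hi, rfl⟩ := Finset.mem_image.1 ha
      exact Finset.mem_filter.2 ⟨hmem i (hsub hi), hmono i (hsub hi) k hk' (Finset.mem_Ico.1 hi).2⟩
    · have : f' k = fstar := if_neg hkn
      rw [this]
      refine le_trans (le_of_eq (Finset.sum_eq_zero fun i _ => ?_)) hβ0
      rw [meanLoss_fstar hT h _ _ (η 0).1]
      simp

/-- The eluder condition for the sequence `f, fstar, fstar, …` bounds a single mean loss. -/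
theorem L2EluderCondition.norm_meanLoss_le {R Cel d : ℝ} {K : ℕ} {fstar : F}
    (hel : L2EluderCondition M ℓ R Cel d K) (hT : IsDecomposable M ℓ fstar) (hK : 1 ≤ K)
    (hR : 0 ≤ R) (hd : 0 ≤ Cel * d) (h : Fin H) (f : F) (η : S × A × B) :
    ‖meanLoss M ℓ h f η f f‖ ≤ R * √(Cel * d) := by
  have h1 := hel.sum_le hT (sq_nonneg R) le_rfl h (fun _ => f) (fun _ => η) (P := {0})
    (by simpa using hK) (by
      intro k hk
      rw [Finset.mem_singleton.1 hk]
      simp [sq_nonneg])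
  simp only [Finset.sum_singleton, Finset.card_singleton] at h1
  have hlog : Real.log ((1 : ℕ) + 1) ≤ 1 := by
    have := Real.log_two_lt_d9
    norm_num at this ⊢
    linarith
  refine (abs_le_of_sq_le_sq' ?_ (by positivity)).2
  rw [mul_pow, Real.sq_sqrt hd]
  refine h1.trans ?_
  have : 0 ≤ R ^ 2 * (Cel * d) := by positivity
  nlinarith

end Eluder

/-! ### Losses along the batches -/

section Batches

variable {S A B G : Type*} [MeasurableSpace S] [MeasurableSpace A] [MeasurableSpace B]
  {F : Set G} {H p : ℕ} {M : MarkovGame S A B H} {ℓ : LossFunction S A B F H p}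

/-- The mean losses along a run whose confidence sets control the data before the current batch. The
first term comes from the episodes before which the loss of the current batch is at most `β`, the
second one from the others. The latter are counted by charging each of them to the regular episodes
of its batch, whose squared losses sum up to more than `β`. -/
theorem sum_norm_meanLoss_le {R Cel d β : ℝ} {K m o : ℕ} {fstar : F}
    (hel : L2EluderCondition M ℓ R Cel d K) (hT : IsDecomposable M ℓ fstar)
    (hm : 1 ≤ m) (ho : o ≤ 1) (hCd : 0 ≤ Cel * d) (hR : 0 ≤ R) (hβ0 : 0 < β) (hβ : R ^ 2 ≤ β)
    (h : Fin H) (f : ℕ → F) (η : ℕ → S × A × B)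
    (keep : ∀ k ∈ Finset.Icc 1 K, k + 1 ≤ K → ¬ IsUpdate m o k → f (k + 1) = f k)
    (hconf : ∀ k ∈ Finset.Icc 1 K, ∑ i ∈ Finset.Icc 1 (lastUpdate m o (k - 1)),
      ‖meanLoss M ℓ h (f i) (η i) (f k) (f k)‖ ^ 2 ≤ β)
    (hb : ∀ i, ‖meanLoss M ℓ h (f i) (η i) (f i) (f i)‖ ≤ R) :
    ∑ i ∈ Finset.Icc 1 K, ‖meanLoss M ℓ h (f i) (η i) (f i) (f i)‖ ≤
      √(K * (Cel * d * (2 * β) * Real.log (K + 1))) +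
        R * (2 * m * (Cel * d) * Real.log (K + 1)) := by
  classical
  set t : ℕ → ℕ := fun k => lastUpdate m o (k - 1) with ht
  set x : ℕ → ℝ := fun i => ‖meanLoss M ℓ h (f i) (η i) (f i) (f i)‖ with hx
  have ht_lt : ∀ k, 1 ≤ k → t k < k := fun k hk => by
    have := lastUpdate_le m o (k - 1)
    simp only [ht]; omega
  have ht_eq : ∀ k i, i ∈ Finset.Ioo (t k) k → t i = t k := fun k i hi => by
    have hi := Finset.mem_Ioo.1 hi
    simp only [ht] at hi ⊢
    exact lastUpdate_eq_of_lt (by omega) (by omega)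
  have hf_eq : ∀ k ∈ Finset.Icc 1 K, ∀ i ∈ Finset.Ioo (t k) k, f k = f i := fun k hk i hi => by
    have hk := Finset.mem_Icc.1 hk
    have hi := Finset.mem_Ioo.1 hi
    simp only [ht] at hi
    have := eq_of_lastUpdate_lt keep (i := i - 1) (k := k - 1) (by omega) (by omega) (by omega)
    rwa [Nat.sub_add_cancel hk.1, Nat.sub_add_cancel (by omega)] at this
  -- The episodes before which the loss of the current batch is still at most `β`.
  set P : Finset ℕ := {k ∈ Finset.Icc 1 K | ∑ i ∈ Finset.Ioo (t k) k, x i ^ 2 ≤ β} with hP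
  set Q : Finset ℕ := {k ∈ Finset.Icc 1 K | ¬ ∑ i ∈ Finset.Ioo (t k) k, x i ^ 2 ≤ β} with hQ
  have hPcard : P.card ≤ K := (Finset.card_filter_le _ _).trans (by simp)
  have hlogK : Real.log (P.card + 1) ≤ Real.log (K + 1) := by
    apply Real.log_le_log (by positivity)
    have : (P.card : ℝ) ≤ K := by exact_mod_cast hPcard
    linarith
  set D : ℝ := Cel * d * (2 * β) * Real.log (K + 1) with hD
  have hPsum : ∑ i ∈ P, x i ^ 2 ≤ D := by
    refine (hel.sum_le hT (β := 2 * β) (by linarith) (by linarith) h f η hPcard ?_).trans ?_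
    · intro k hk
      obtain ⟨hkK, hkb⟩ := Finset.mem_filter.1 hk
      have hsub : {i ∈ P | i < k} ⊆ Finset.Icc 1 (t k) ∪ Finset.Ioo (t k) k := by
        intro i hi
        obtain ⟨hiP, hik⟩ := Finset.mem_filter.1 hi
        have := Finset.mem_Icc.1 (Finset.mem_filter.1 hiP).1
        rw [Finset.mem_union, Finset.mem_Icc, Finset.mem_Ioo]
        omega
      have hdisj : Disjoint (Finset.Icc 1 (t k)) (Finset.Ioo (t k) k) := by
        rw [Finset.disjoint_left]
        intro i hi hi'
        have := Finset.mem_Icc.1 hi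
        have := Finset.mem_Ioo.1 hi'
        omega
      refine (Finset.sum_le_sum_of_subset_of_nonneg hsub fun _ _ _ => sq_nonneg _).trans ?_
      rw [Finset.sum_union hdisj]
      have h2 : ∑ i ∈ Finset.Ioo (t k) k, ‖meanLoss M ℓ h (f i) (η i) (f k) (f k)‖ ^ 2 ≤ β := by
        refine le_trans (le_of_eq (Finset.sum_congr rfl fun i hi => ?_)) hkb
        rw [hf_eq k hkK i hi]
      linarith [hconf k hkK]
    · rw [hD]
      have : 0 ≤ Cel * d * (2 * β) := by positivity
      nlinarith
  have hout : ∀ k ∈ Q, β ≤ ∑ i ∈ P with t i = t k, x i ^ 2 := by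
    intro k
    induction k using Nat.strong_induction_on with
    | _ k ih =>
      intro hk
      obtain ⟨hkK, hkb⟩ := Finset.mem_filter.1 hk
      by_cases hall : ∀ i ∈ Finset.Ioo (t k) k, i ∈ P
      · refine (not_le.1 hkb).le.trans
          (Finset.sum_le_sum_of_subset_of_nonneg (fun i hi => ?_) fun _ _ _ => sq_nonneg _)
        exact Finset.mem_filter.2 ⟨hall i hi, ht_eq k i hi⟩
      · push Not at hall
        obtain ⟨i, hi, hiP⟩ := hall
        have hi' := Finset.mem_Ioo.1 hi
        have hiK : i ∈ Finset.Icc 1 K := Finset.mem_Icc.2 ⟨by omega, by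
          have := Finset.mem_Icc.1 hkK; omega⟩
        have hiQ : i ∈ Q := Finset.mem_filter.2 ⟨hiK, fun hle => hiP (Finset.mem_filter.2 ⟨hiK, hle⟩)⟩
        have := ih i hi'.2 hiQ
        rwa [ht_eq k i hi] at this
  have hbatch : ∀ s, (({k ∈ Q | s = t k} : Finset ℕ).card : ℝ) ≤ m := by
    intro s
    have hsub : ({k ∈ Q | s = t k} : Finset ℕ) ⊆ Finset.Ioc s (s + m) := by
      intro k hk
      obtain ⟨hkQ, hkt⟩ := Finset.mem_filter.1 hk
      have h1 := (Finset.mem_Icc.1 (Finset.mem_filter.1 hkQ).1).1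
      have h2 := ht_lt k h1
      have h3 := lt_lastUpdate_add hm ho (k - 1)
      rw [Finset.mem_Ioc]
      simp only [ht] at hkt h2
      omega
    have := Finset.card_le_card hsub
    simp only [Nat.card_Ioc, add_tsub_cancel_left] at this
    exact_mod_cast this
  have hQcard : (Q.card : ℝ) * β ≤ m * D := by
    calc (Q.card : ℝ) * β = ∑ k ∈ Q, β := by simp
      _ ≤ ∑ k ∈ Q, ∑ i ∈ P with t i = t k, x i ^ 2 := Finset.sum_le_sum hout
      _ = ∑ i ∈ P, ∑ k ∈ Q with t i = t k, x i ^ 2 := by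
          simp_rw [Finset.sum_filter]
          exact Finset.sum_comm
      _ = ∑ i ∈ P, (({k ∈ Q | t i = t k} : Finset ℕ).card : ℝ) * x i ^ 2 := by simp
      _ ≤ ∑ i ∈ P, (m : ℝ) * x i ^ 2 :=
          Finset.sum_le_sum fun i _ => mul_le_mul_of_nonneg_right (hbatch _) (sq_nonneg _)
      _ = m * ∑ i ∈ P, x i ^ 2 := by rw [Finset.mul_sum]
      _ ≤ m * D := by gcongr
  have hQcard' : (Q.card : ℝ) ≤ 2 * m * (Cel * d) * Real.log (K + 1) := by
    refine le_of_mul_le_mul_right (hQcard.trans (le_of_eq ?_)) hβ0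
    rw [hD]; ring
  have hPx : ∑ i ∈ P, x i ≤ √(K * D) := by
    refine Real.le_sqrt_of_sq_le ?_
    refine sq_sum_le_card_mul_sum_sq.trans ?_
    have : (P.card : ℝ) ≤ K := by exact_mod_cast hPcard
    have h0 : 0 ≤ ∑ i ∈ P, x i ^ 2 := Finset.sum_nonneg fun _ _ => sq_nonneg _
    gcongr
  have hQx : ∑ i ∈ Q, x i ≤ R * (2 * m * (Cel * d) * Real.log (K + 1)) := by
    refine (Finset.sum_le_card_nsmul Q x R fun i _ => hb i).trans ?_
    rw [nsmul_eq_mul, mul_comm]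
    gcongr
  rw [← Finset.sum_filter_add_sum_filter_not (Finset.Icc 1 K)
    (fun k => ∑ i ∈ Finset.Ioo (t k) k, x i ^ 2 ≤ β)]
  exact add_le_add hPx hQx

end Batches

/-- The arithmetic of the regret bound for one step of the horizon: `X` is the sum of the observed
losses, `Y` the sum of the expected ones, `R √(Cel d)` bounds a single loss. -/
theorem expected_loss_sum_le {R Cel d β ι X Y : ℝ} {K Bt m : ℕ} (hR : 0 ≤ R) (hCel : 0 < Cel)
    (hd : 0 ≤ d) (hK : 2 ≤ K) (hBt : 1 ≤ Bt) (hι : 0 ≤ ι) (hβ : R ^ 2 * ι ≤ β)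
    (hmB : (m : ℝ) ≤ K / Bt)
    (hX : X ≤ √(K * (Cel * d * (2 * (4 * β)) * Real.log (K + 1))) +
        R * (2 * m * (Cel * d) * Real.log (K + 1)))
    (hX0 : 0 ≤ X)
    (hY : Y ≤ 2 * X + 2 * (R * √(Cel * d)) * ι) (hY' : Y ≤ K * (R * √(Cel * d))) :
    Y ≤ (4 * √(8 * Cel) + 4 * √Cel + 16 * R * Cel) *
      (√(d * β * K) * Real.log K + d * K / Bt * Real.log K ^ 2) := by
  have hK' : (2 : ℝ) ≤ K := by exact_mod_cast hK
  have hBt' : (1 : ℝ) ≤ Bt := by exact_mod_cast hBt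
  set u := Real.log K with hu
  have hu1 : 1 ≤ 2 * u := by
    have h1 : Real.log 2 ≤ u := Real.log_le_log (by norm_num) hK'
    linarith [Real.log_two_gt_d9]
  have hβ0 : 0 ≤ β := le_trans (by positivity) hβ
  set L := Real.log (K + 1) with hL
  have hL0 : 0 ≤ L := Real.log_nonneg (by linarith)
  have hLu : L ≤ 2 * u := by
    rw [hL, hu, ← Nat.cast_ofNat, ← Real.log_pow]
    exact Real.log_le_log (by linarith) (by nlinarith)
  set q := √(d * β * K) with hq
  have hq0 : 0 ≤ q := Real.sqrt_nonneg _
  have h1 : √(K * (Cel * d * (2 * (4 * β)) * L)) ≤ √(8 * Cel) * q * (2 * u) := by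
    rw [hq, ← Real.sqrt_mul (by positivity)]
    refine Real.sqrt_le_iff.2 ⟨by positivity, ?_⟩
    rw [mul_pow, Real.sq_sqrt (by positivity)]
    have : L ≤ (2 * u) ^ 2 := by nlinarith
    have h2 : 0 ≤ 8 * Cel * (d * β * K) := by positivity
    nlinarith
  have h2 : R * (2 * m * (Cel * d) * L) ≤ 8 * R * Cel * (d * K / Bt * u ^ 2) := by
    have hLu2 : L ≤ 4 * u ^ 2 := by nlinarith
    calc R * (2 * m * (Cel * d) * L) ≤ R * (2 * (K / Bt) * (Cel * d) * (4 * u ^ 2)) := by gcongr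
      _ = 8 * R * Cel * (d * K / Bt * u ^ 2) := by ring
  set r := R * √(Cel * d) with hr
  have hr0 : 0 ≤ r := by positivity
  -- Since `Y ≤ K r` as well, the deviation term `r ι` only matters when `ι ≤ K`.
  have h3 : Y ≤ 2 * X + 2 * (r * √(ι * K)) := by
    rcases le_total ι K with h | h
    · have : ι ≤ √(ι * K) := Real.le_sqrt_of_sq_le (by nlinarith)
      nlinarith [mul_le_mul_of_nonneg_left this hr0]
    · have : (K : ℝ) ≤ √(ι * K) := Real.le_sqrt_of_sq_le (by nlinarith)
      nlinarith [mul_le_mul_of_nonneg_left this hr0]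
  have h4 : r * √(ι * K) ≤ √Cel * q := by
    have hRs : R = √(R ^ 2) := (Real.sqrt_sq hR).symm
    rw [hr, hRs, hq, ← Real.sqrt_mul (by positivity), ← Real.sqrt_mul (by positivity),
      ← Real.sqrt_mul hCel.le]
    refine Real.sqrt_le_sqrt ?_
    have h5 : 0 ≤ Cel * d * K := by positivity
    nlinarith [mul_le_mul_of_nonneg_left hβ h5]
  have h5 : √Cel * q ≤ √Cel * q * (2 * u) := le_mul_of_one_le_right (by positivity) hu1
  have h6 : 0 ≤ √(8 * Cel) * (d * K / Bt * u ^ 2) := by positivity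
  have h7 : 0 ≤ √Cel * (d * K / Bt * u ^ 2) := by positivity
  have h8 : 0 ≤ R * Cel * (q * u) := by
    have : 0 ≤ u := by linarith
    positivity
  nlinarith

/-! ### Concentration of the empirical losses -/

section Excess

variable {E : Type*} [NormedAddCommGroup E] [InnerProductSpace ℝ E]

/-- For a random vector `w` with mean `v`: half of `‖v‖²` minus the drop `‖w‖² - ‖w - v‖²` of the
squared loss when `w` is centred. -/
noncomputable def excess (v w : E) : ℝ := ‖v‖ ^ 2 / 2 - (‖w‖ ^ 2 - ‖w - v‖ ^ 2)

open scoped InnerProductSpace in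
theorem excess_eq (v w : E) : excess v w = ‖v‖ ^ 2 / 2 - (2 * ⟪v, w⟫_ℝ - ‖v‖ ^ 2) := by
  rw [excess, norm_sub_sq_real, real_inner_comm]
  ring

open scoped InnerProductSpace in
theorem excess_le_add {v w v' w' : E} {R ε : ℝ} (hv : ‖v‖ ≤ R) (hv' : ‖v'‖ ≤ R)
    (hw : ‖w‖ ≤ R) (hvv : ‖v - v'‖ ≤ ε) (hww : ‖w - w'‖ ≤ ε) :
    excess v w ≤ excess v' w' + 7 * R * ε := by
  rw [excess_eq, excess_eq]
  have hε : 0 ≤ ε := (norm_nonneg _).trans hvv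
  have hR : 0 ≤ R := (norm_nonneg _).trans hv
  have h1 : ‖v‖ ^ 2 - ‖v'‖ ^ 2 ≤ 2 * R * ε := by
    have h2 : ‖v‖ - ‖v'‖ ≤ ε := (norm_sub_norm_le _ _).trans hvv
    nlinarith [norm_nonneg v, norm_nonneg v']
  have h2 : ⟪v', w'⟫_ℝ - ⟪v, w⟫_ℝ ≤ 2 * R * ε := by
    have h3 : ⟪v', w'⟫_ℝ - ⟪v, w⟫_ℝ = -⟪v - v', w⟫_ℝ - ⟪v', w - w'⟫_ℝ := by
      rw [inner_sub_left, inner_sub_right]; ring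
    have h4 : -⟪v - v', w⟫_ℝ ≤ ε * R := (neg_le_abs _).trans
      ((abs_real_inner_le_norm _ _).trans (mul_le_mul hvv hw (norm_nonneg _) hε))
    have h5 : -⟪v', w - w'⟫_ℝ ≤ R * ε := (neg_le_abs _).trans
      ((abs_real_inner_le_norm _ _).trans (mul_le_mul hv' hww (norm_nonneg _) hR))
    linarith
  linarith

end Excess

section Run

variable {S A B G : Type*} [MeasurableSpace S] [MeasurableSpace A] [MeasurableSpace B]
  [MeasurableSpace G] {F : Set G} {H p : ℕ} {M : MarkovGame S A B H}
  {D : HypothesisData S A B F} {ℓ : LossFunction S A B F H p} {s₁ : S} {β : ℝ} {K m o : ℕ}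
  {Ω : Type*} {mΩ : MeasurableSpace Ω} {Pr : Measure Ω} {ℱ : Filtration ℕ mΩ}
  {f : ℕ → Ω → F} {ν : ℕ → Ω → MarkovPolicy S B} {τ : ℕ → Ω → Trajectory S A B H}

theorem measurable_integral_trans (M : MarkovGame S A B H) (h : ℕ)
    {φ : F × S × (S × A × B) → EuclideanSpace ℝ (Fin p)} (hφ : Measurable φ) :
    Measurable fun q : F × (S × A × B) => ∫ ζ, φ (q.1, ζ, q.2) ∂M.trans h q.2 := by
  have := M.markov_trans h
  have h1 : StronglyMeasurable fun q : (F × (S × A × B)) × S => φ (q.1.1, q.2, q.1.2) :=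
    (hφ.comp (by fun_prop)).stronglyMeasurable
  exact (h1.integral_kernel_prod_right'
    (κ := Kernel.prodMkLeft F (M.trans h))).measurable

theorem norm_integral_trans_le (M : MarkovGame S A B H) (h : ℕ) (η : S × A × B)
    {Y : S → EuclideanSpace ℝ (Fin p)} {R : ℝ} (hY : ∀ ζ, ‖Y ζ‖ ≤ R) :
    ‖∫ ζ, Y ζ ∂M.trans h η‖ ≤ R := by
  have := M.markov_trans h
  simpa using norm_integral_le_of_norm_le_const (μ := M.trans h η)
    (Filter.Eventually.of_forall hY)

/-- The concentration bound for one function `φ` and one step `h`. The function need not be a loss of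
the same step: members of the cover of the loss class may stem from other steps. -/
theorem IsBatchRun.measure_lt_sum_excess [IsProbabilityMeasure Pr]
    (hrun : IsBatchRun M D ℓ s₁ β K m o Pr ℱ f ν τ)
    {φ : F × S × (S × A × B) → EuclideanSpace ℝ (Fin p)} (hφ : Measurable φ) {R : ℝ}
    (hR : 0 < R) (hφR : ∀ q, ‖φ q‖ ≤ R) (h : Fin H) {n : ℕ} (hn : n ≤ K) (b : ℝ) :
    Pr {ω | 4 * R ^ 2 * b < ∑ i ∈ Finset.Icc 1 n,
      excess (∫ ζ, φ (f i ω, ζ, (τ i ω h).1) ∂M.trans h (τ i ω h).1)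
        (φ (f i ω, (τ i ω h).2, (τ i ω h).1))} ≤ ENNReal.ofReal (Real.exp (-b)) := by
  have hsub := Finset.Icc_subset_Icc_right (a := 1) hn
  have := M.markov_trans h
  let Z : F × ((S × A × B) × S) → ℝ := fun q =>
    excess (∫ ζ, φ (q.1, ζ, q.2.1) ∂M.trans h q.2.1) (φ (q.1, q.2.2, q.2.1)) / (4 * R ^ 2)
  have hZ : Measurable Z := by
    have h1 : Measurable fun q : F × ((S × A × B) × S) =>
        ∫ ζ, φ (q.1, ζ, q.2.1) ∂M.trans h q.2.1 :=
      (measurable_integral_trans M h hφ).comp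
        (f := fun q : F × ((S × A × B) × S) => (q.1, q.2.1)) (by fun_prop)
    have h2 : Measurable fun q : F × ((S × A × B) × S) => φ (q.1, q.2.2, q.2.1) :=
      hφ.comp (by fun_prop)
    simp only [Z, excess]
    fun_prop
  have hmain := measure_lt_sum_of_lintegral_exp_le_one (Pr := Pr) (ℱ := ℱ) (n := n)
    (κ := fun i ω => M.rollout (D.maxPolicy (f i ω)) (ν i ω) H 0 s₁) (fun i ω => inferInstance)
    (τ := τ) (fun i hi => hrun.measurable_traj i (hsub hi)) (fun i hi => hrun.law i (hsub hi))
    (z := fun i q => Z (f i q.1, q.2 h)) (fun i hi => ?_) (fun i hi => ?_) b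
  · refine (measure_mono fun ω hω => ?_).trans hmain
    rw [Set.mem_ofPred_eq] at hω ⊢
    simp only [Z]
    rwa [← Finset.sum_div, lt_div_iff₀ (by positivity), mul_comm]
  · refine hZ.comp ?_
    exact Measurable.prodMk
      ((hrun.measurable_f i (hsub hi)).comp (@measurable_fst Ω _ (ℱ (i - 1)) _))
      ((measurable_pi_apply h).comp (@measurable_snd Ω _ (ℱ (i - 1)) _))
  · refine Filter.Eventually.of_forall fun ω => ?_
    refine M.lintegral_rollout_le_one _ _ 0 h
      (ψ := fun y => ENNReal.ofReal (Real.exp (Z (f i ω, y)))) ?_ (fun η => ?_) s₁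
    · exact (Real.measurable_exp.comp (hZ.comp measurable_prodMk_left)).ennreal_ofReal
    · simp only [Z, excess_eq, zero_add]
      refine lintegral_exp_excess_le_one (Y := fun ζ => φ (f i ω, ζ, η)) ?_ hR (fun ζ => hφR _) rfl
      exact (hφ.comp (by fun_prop)).aestronglyMeasurable

theorem IsBatchRun.measure_lt_sum_integral_norm_meanLoss [IsProbabilityMeasure Pr]
    (hrun : IsBatchRun M D ℓ s₁ β K m o Pr ℱ f ν τ)
    (hmeas : ∀ h, Measurable (fun x : F × S × (S × A × B) => ℓ h x.1 x.2.1 x.2.2 x.1 (x.1 : G)))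
    {r : ℝ} (hr : 0 ≤ r) (h : Fin H) (hℓr : ∀ f η, ‖meanLoss M ℓ h f η f f‖ ≤ r) (b : ℝ) :
    Pr {ω | 2 * ∑ i ∈ Finset.Icc 1 K, ‖meanLoss M ℓ h (f i ω) (τ i ω h).1 (f i ω) (f i ω)‖ +
        2 * r * b < ∑ i ∈ Finset.Icc 1 K,
          ∫ t, ‖meanLoss M ℓ h (f i ω) (t h).1 (f i ω) (f i ω)‖
            ∂(M.rollout (D.maxPolicy (f i ω)) (ν i ω) H 0 s₁)} ≤
      ENNReal.ofReal (Real.exp (-b)) := by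
  have hZ : Measurable fun q : F × (S × A × B) => ‖meanLoss M ℓ h q.1 q.2 q.1 q.1‖ :=
    (measurable_integral_trans M h (hmeas h)).norm
  refine measure_lt_sum_integral (ℱ := ℱ)
    (κ := fun i ω => M.rollout (D.maxPolicy (f i ω)) (ν i ω) H 0 s₁) (fun i ω => inferInstance)
    hrun.measurable_traj hrun.law
    (x := fun i q => ‖meanLoss M ℓ h (f i q.1) (q.2 h).1 (f i q.1) (f i q.1)‖)
    (fun i hi => ?_) hr (fun i q => norm_nonneg _) (fun i q => hℓr _ _) b
  refine hZ.comp (f := fun q : Ω × Trajectory S A B H => (f i q.1, (q.2 h).1)) ?_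
  exact Measurable.prodMk
    ((hrun.measurable_f i hi).comp (@measurable_fst Ω _ (ℱ (i - 1)) _))
    (measurable_fst.comp ((measurable_pi_apply h).comp (@measurable_snd Ω _ (ℱ (i - 1)) _)))

end Run

section UniformConcentration

variable {S A B G : Type*} [MeasurableSpace S] [MeasurableSpace A] [MeasurableSpace B]
  [MeasurableSpace G] {F : Set G} {H p : ℕ} {M : MarkovGame S A B H}
  {D : HypothesisData S A B F} {ℓ : LossFunction S A B F H p} {s₁ : S} {β : ℝ} {K m o : ℕ}
  {Ω : Type*} {mΩ : MeasurableSpace Ω} {Pr : Measure Ω} {ℱ : Filtration ℕ mΩ}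
  {f : ℕ → Ω → F} {ν : ℕ → Ω → MarkovPolicy S B} {τ : ℕ → Ω → Trajectory S A B H}

/-- Uniform concentration over the loss class. For each of the `H` steps, the `N` members of the cover
and the `K` episodes, the bound fails with probability at most `exp (-b)`; replacing a loss by a member
of the cover changes each of at most `K` summands by at most `7R / K`. -/
theorem IsBatchRun.measure_exists_lt_sum_excess [IsProbabilityMeasure Pr]
    (hrun : IsBatchRun M D ℓ s₁ β K m o Pr ℱ f ν τ) {R : ℝ} (hR0 : 0 ≤ R)
    (hℓ : IsBoundedLoss ℓ R) {N : ℕ} (hK : 1 ≤ K)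
    (hN : Metric.coveringNumber (1 / (K : NNReal)) (lossClass ℓ) = N) {b : ℝ} (hb : 0 ≤ b) :
    Pr {ω | ¬ ∀ (h : Fin H) (f' : F) (g : G), ∀ k ≤ K, ∑ i ∈ Finset.Icc 1 k,
      excess (meanLoss M ℓ h (f i ω) (τ i ω h).1 f' g)
        (ℓ h (f i ω) (τ i ω h).2 (τ i ω h).1 f' g) ≤ 4 * R ^ 2 * b + 7 * R} ≤
      H * N * K * ENNReal.ofReal (Real.exp (-b)) := by
  rcases hR0.eq_or_lt with rfl | hR
  · have h0 : ∀ h f' ζ η f g, ℓ h f' ζ η f g = 0 := fun h f' ζ η f g =>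
      norm_le_zero_iff.1 (hℓ.norm_le h f' ζ η f g)
    simp [meanLoss, h0, excess]
  have hK0 : (0 : ℝ) < K := by exact_mod_cast hK
  obtain ⟨C, hCsub, hCfin, hCcover, hCcard⟩ :=
    Metric.exists_set_encard_eq_coveringNumber (ε := 1 / (K : NNReal)) (A := lossClass ℓ)
      (by rw [hN]; exact ENat.natCast_ne_top N)
  set C' := hCfin.toFinset with hC'
  have hC'card : C'.card = N := by
    rw [hN, hCfin.encard_eq_coe_toFinset_card] at hCcard
    exact_mod_cast hCcard
  let φ : ((F × S × (S × A × B)) →ᵤ EuclideanSpace ℝ (Fin p)) →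
    F × S × (S × A × B) → EuclideanSpace ℝ (Fin p) := fun y => UniformFun.toFun y
  have hφ : ∀ y ∈ C', Measurable (φ y) ∧ ∀ q, ‖φ y q‖ ≤ R := by
    intro y hy
    obtain ⟨h, f', g, rfl⟩ := hCsub (hCfin.mem_toFinset.1 hy)
    exact ⟨hℓ.measurable h f' g, fun q => hℓ.norm_le h _ _ _ f' g⟩
  let bad : Fin H → ((F × S × (S × A × B)) →ᵤ EuclideanSpace ℝ (Fin p)) → ℕ → Set Ω :=
    fun h y n => {ω | 4 * R ^ 2 * b < ∑ i ∈ Finset.Icc 1 n,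
      excess (∫ ζ, φ y (f i ω, ζ, (τ i ω h).1) ∂M.trans h (τ i ω h).1)
        (φ y (f i ω, (τ i ω h).2, (τ i ω h).1))}
  have hsub : {ω | ¬ ∀ (h : Fin H) (f' : F) (g : G), ∀ k ≤ K, ∑ i ∈ Finset.Icc 1 k,
      excess (meanLoss M ℓ h (f i ω) (τ i ω h).1 f' g)
        (ℓ h (f i ω) (τ i ω h).2 (τ i ω h).1 f' g) ≤ 4 * R ^ 2 * b + 7 * R} ⊆
      ⋃ h ∈ (Finset.univ : Finset (Fin H)), ⋃ y ∈ C', ⋃ n ∈ Finset.Icc 1 K, bad h y n := by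
    intro ω hω
    rw [Set.mem_ofPred_eq] at hω
    by_contra hnot
    refine hω fun h f' g k hk => ?_
    rcases Nat.eq_zero_or_pos k with rfl | hk0
    · simp only [Finset.Icc_eq_empty_of_lt zero_lt_one, Finset.sum_empty]
      positivity
    obtain ⟨y, hyC, hyd⟩ := hCcover (show UniformFun.ofFun
      (fun x : F × S × (S × A × B) => ℓ h x.1 x.2.1 x.2.2 f' g) ∈ lossClass ℓ from ⟨h, f', g, rfl⟩)
    have hyC' : y ∈ C' := hCfin.mem_toFinset.2 hyC
    obtain ⟨hφm, hφR⟩ := hφ y hyC'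
    have hdist : ∀ f₀ ζ η, ‖ℓ h f₀ ζ η f' g - φ y (f₀, ζ, η)‖ ≤ 1 / K := by
      intro f₀ ζ η
      have h1 := UniformFun.edist_le.1 hyd (f₀, ζ, η)
      rw [edist_le_coe, ← NNReal.coe_le_coe, coe_nndist, dist_eq_norm] at h1
      simpa using h1
    have hmean : ∀ f₀ η, ‖meanLoss M ℓ h f₀ η f' g - ∫ ζ, φ y (f₀, ζ, η) ∂M.trans h η‖ ≤ 1 / K := by
      intro f₀ η
      have := M.markov_trans h
      rw [meanLoss, ← integral_sub]
      · exact norm_integral_trans_le M h η fun ζ => hdist f₀ ζ η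
      · exact Integrable.of_bound ((hℓ.measurable h f' g).comp
          (g := fun x : F × S × (S × A × B) => ℓ h x.1 x.2.1 x.2.2 f' g)
          (f := fun ζ : S => (f₀, ζ, η)) (by fun_prop)).aestronglyMeasurable R
          (Filter.Eventually.of_forall fun ζ => hℓ.norm_le _ _ _ _ _ _)
      · exact Integrable.of_bound
          (hφm.comp (f := fun ζ : S => (f₀, ζ, η)) (by fun_prop)).aestronglyMeasurable R
          (Filter.Eventually.of_forall fun ζ => hφR _)
    have hgood : ∑ i ∈ Finset.Icc 1 k,
        excess (∫ ζ, φ y (f i ω, ζ, (τ i ω h).1) ∂M.trans h (τ i ω h).1)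
          (φ y (f i ω, (τ i ω h).2, (τ i ω h).1)) ≤ 4 * R ^ 2 * b := by
      by_contra hlt
      refine hnot ?_
      simp only [Set.mem_iUnion]
      exact ⟨h, Finset.mem_univ h, y, hyC', k, Finset.mem_Icc.2 ⟨hk0, hk⟩, not_le.1 hlt⟩
    calc ∑ i ∈ Finset.Icc 1 k, excess (meanLoss M ℓ h (f i ω) (τ i ω h).1 f' g)
          (ℓ h (f i ω) (τ i ω h).2 (τ i ω h).1 f' g)
        ≤ ∑ i ∈ Finset.Icc 1 k,
            (excess (∫ ζ, φ y (f i ω, ζ, (τ i ω h).1) ∂M.trans h (τ i ω h).1)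
              (φ y (f i ω, (τ i ω h).2, (τ i ω h).1)) + 7 * R * (1 / K)) :=
          Finset.sum_le_sum fun i _ => excess_le_add
            (norm_integral_trans_le M h _ fun ζ => hℓ.norm_le _ _ _ _ _ _)
            (norm_integral_trans_le M h _ fun ζ => hφR _) (hℓ.norm_le _ _ _ _ _ _)
            (hmean _ _) (hdist _ _ _)
      _ ≤ 4 * R ^ 2 * b + 7 * R := by
          rw [Finset.sum_add_distrib]
          refine add_le_add hgood ?_
          have hkK : (k : ℝ) ≤ K := by exact_mod_cast hk
          simp only [Finset.sum_const, Nat.card_Icc, add_tsub_cancel_right, nsmul_eq_mul]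
          calc (k : ℝ) * (7 * R * (1 / K)) ≤ K * (7 * R * (1 / K)) := by gcongr
            _ = 7 * R := by field_simp
  refine (measure_mono hsub).trans ?_
  calc Pr (⋃ h ∈ (Finset.univ : Finset (Fin H)), ⋃ y ∈ C', ⋃ n ∈ Finset.Icc 1 K, bad h y n)
      ≤ ∑ h : Fin H, ∑ y ∈ C', ∑ n ∈ Finset.Icc 1 K, Pr (bad h y n) :=
        (measure_biUnion_finset_le _ _).trans <| Finset.sum_le_sum fun h _ =>
          (measure_biUnion_finset_le _ _).trans <| Finset.sum_le_sum fun y _ =>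
            measure_biUnion_finset_le _ _
    _ ≤ ∑ h : Fin H, ∑ y ∈ C', ∑ n ∈ Finset.Icc 1 K, ENNReal.ofReal (Real.exp (-b)) :=
        Finset.sum_le_sum fun h _ => Finset.sum_le_sum fun y hy => Finset.sum_le_sum fun n hn =>
          hrun.measure_lt_sum_excess (hφ y hy).1 hR (hφ y hy).2 h (Finset.mem_Icc.1 hn).2 b
    _ = H * N * K * ENNReal.ofReal (Real.exp (-b)) := by
        simp only [Finset.sum_const, Finset.card_univ, Fintype.card_fin, hC'card, Nat.card_Icc,
          add_tsub_cancel_right, nsmul_eq_mul]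
        ring

end UniformConcentration

/-! ### Consequences for the confidence sets -/

section Confidence

variable {S A B G : Type*} [MeasurableSpace S] [MeasurableSpace A] [MeasurableSpace B]
  {F : Set G} {H p : ℕ} {M : MarkovGame S A B H} {ℓ : LossFunction S A B F H p}

/-- By decomposability, the total excess of a loss over its mean is a difference of empirical losses. -/
theorem sum_excess_eq {T : F → G}
    (hdec : ∀ h f' ζ η f g, ℓ h f' ζ η f g - meanLoss M ℓ h f' η f g = ℓ h f' ζ η f (T f))
    (fs : ℕ → F) (τs : ℕ → Trajectory S A B H) (h : Fin H) (k : ℕ) (f : F) (g : G) :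
    ∑ i ∈ Finset.Icc 1 k, excess (meanLoss M ℓ h (fs i) (τs i h).1 f g)
        (ℓ h (fs i) (τs i h).2 (τs i h).1 f g) =
      (∑ i ∈ Finset.Icc 1 k, ‖meanLoss M ℓ h (fs i) (τs i h).1 f g‖ ^ 2) / 2 -
        (empLoss ℓ fs τs h k f g - empLoss ℓ fs τs h k f (T f)) := by
  simp only [excess, hdec, empLoss, Finset.sum_sub_distrib, Finset.sum_div]

variable {fs : ℕ → F} {τs : ℕ → Trajectory S A B H} {β : ℝ} {K m o : ℕ}

theorem fstar_mem_confidenceSet {fstar : F} (hT : IsDecomposable M ℓ fstar) (hβ : 0 ≤ β)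
    (hexc : ∀ (h : Fin H) (f' : F) (g : G), ∀ k ≤ K, ∑ i ∈ Finset.Icc 1 k,
      excess (meanLoss M ℓ h (fs i) (τs i h).1 f' g) (ℓ h (fs i) (τs i h).2 (τs i h).1 f' g) ≤ β)
    {k : ℕ} (hk : k ≤ K) : fstar ∈ confidenceSet ℓ β m o fs τs k := by
  have : Nonempty G := ⟨fstar⟩
  obtain ⟨T, hTs, hdec⟩ := hT
  rw [mem_confidenceSet_iff ℓ hβ]
  intro h
  rw [sub_le_comm]
  refine le_ciInf fun g => ?_
  have h1 := hexc h fstar g _ ((lastUpdate_le m o k).trans hk)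
  rw [sum_excess_eq hdec, hTs] at h1
  have h2 : 0 ≤ ∑ i ∈ Finset.Icc 1 (lastUpdate m o k),
      ‖meanLoss M ℓ h (fs i) (τs i h).1 fstar g‖ ^ 2 := Finset.sum_nonneg fun _ _ => sq_nonneg _
  linarith

/-- A hypothesis in the confidence set has a small squared mean loss on the data of the set. -/
theorem sum_sq_norm_meanLoss_le {fstar : F} (hT : IsDecomposable M ℓ fstar) (hβ : 0 ≤ β)
    (hexc : ∀ (h : Fin H) (f' : F) (g : G), ∀ k ≤ K, ∑ i ∈ Finset.Icc 1 k,
      excess (meanLoss M ℓ h (fs i) (τs i h).1 f' g) (ℓ h (fs i) (τs i h).2 (τs i h).1 f' g) ≤ β)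
    {k : ℕ} (hk : k ≤ K) {f : F} (hf : f ∈ confidenceSet ℓ β m o fs τs k) (h : Fin H) :
    ∑ i ∈ Finset.Icc 1 (lastUpdate m o k), ‖meanLoss M ℓ h (fs i) (τs i h).1 f f‖ ^ 2 ≤
      4 * β := by
  obtain ⟨T, -, hdec⟩ := hT
  have h1 := (mem_confidenceSet_iff ℓ hβ m o fs τs k f).1 hf h
  have h2 := ciInf_le (bddBelow_empLoss ℓ fs τs h (lastUpdate m o k) f) (T f)
  have h3 := hexc h f f _ ((lastUpdate_le m o k).trans hk)
  rw [sum_excess_eq hdec] at h3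
  linarith

end Confidence

/-! ### The regret bound -/

section Regret

/-- The failure probabilities add up to at most `δ`: `H N K` events for the empirical losses and `H`
for the expected ones. -/
theorem failure_probability_le {H N K : ℕ} (hH : 1 ≤ H) (hN : 1 ≤ N) (hK : 2 ≤ K) {δ : ℝ}
    (hδ : 0 < δ) :
    H * N * K * ENNReal.ofReal (Real.exp (-Real.log (H * K ^ 2 * N / δ))) +
      H * ENNReal.ofReal (Real.exp (-Real.log (H * K ^ 2 * N / δ))) ≤ ENNReal.ofReal δ := by
  have hH' : (1 : ℝ) ≤ H := by exact_mod_cast hH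
  have hN' : (1 : ℝ) ≤ N := by exact_mod_cast hN
  have hK' : (2 : ℝ) ≤ K := by exact_mod_cast hK
  have hpos : (0 : ℝ) < H * K ^ 2 * N / δ := by positivity
  rw [Real.exp_neg, Real.exp_log hpos, ← add_mul]
  have hcast : (H * N * K + H : ℝ≥0∞) = ENNReal.ofReal (H * N * K + H) := by
    rw [ENNReal.ofReal_add (by positivity) (by positivity), ENNReal.ofReal_mul (by positivity),
      ENNReal.ofReal_mul (by positivity)]
    simp
  rw [hcast, ← ENNReal.ofReal_mul (by positivity)]
  refine ENNReal.ofReal_le_ofReal ?_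
  rw [inv_div, mul_div_assoc', div_le_iff₀ (by positivity)]
  have h1 : N * K + 1 ≤ (K : ℝ) ^ 2 * N := by nlinarith [mul_nonneg (sub_nonneg.2 hN') (sub_nonneg.2 hK')]
  calc ((H : ℝ) * N * K + H) * δ = δ * H * (N * K + 1) := by ring
    _ ≤ δ * H * (K ^ 2 * N) := by gcongr
    _ = δ * (H * K ^ 2 * N) := by ring

theorem one_le_log_count {H N K : ℕ} (hH : 1 ≤ H) (hN : 1 ≤ N) (hK : 2 ≤ K) {δ : ℝ}
    (hδ : 0 < δ) (hδ1 : δ < 1) : 1 ≤ Real.log (H * K ^ 2 * N / δ) := by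
  have hH' : (1 : ℝ) ≤ H := by exact_mod_cast hH
  have hN' : (1 : ℝ) ≤ N := by exact_mod_cast hN
  have hK' : (2 : ℝ) ≤ K := by exact_mod_cast hK
  have h1 : (2 : ℝ) ^ 2 ≤ H * K ^ 2 * N / δ := by
    rw [le_div_iff₀ hδ]
    calc (2 : ℝ) ^ 2 * δ ≤ 2 ^ 2 := by linarith
      _ ≤ (K : ℝ) ^ 2 := by gcongr
      _ ≤ H * (K : ℝ) ^ 2 := le_mul_of_one_le_left (by positivity) hH'
      _ ≤ H * (K : ℝ) ^ 2 * N := le_mul_of_one_le_right (by positivity) hN'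
  have h2 := Real.log_le_log (by norm_num) h1
  rw [Real.log_pow] at h2
  push_cast at h2
  linarith [Real.log_two_gt_d9]

variable {S A B G : Type*} [MeasurableSpace S] [MeasurableSpace A] [MeasurableSpace B]
  [MeasurableSpace G] {F : Set G} {H p : ℕ} {M : MarkovGame S A B H}
  {D : HypothesisData S A B F} {ℓ : LossFunction S A B F H p} {s₁ : S}

/-- The regret bound on a single path on which the concentration and dominance inequalities hold. -/
theorem regret_le_of_concentration {R Cel d κ β ι : ℝ} {K Bt o : ℕ} {fstar : F}
    {υstar : MarkovPolicy S A} {μstar : MarkovPolicy S B}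
    (hR : 0 ≤ R) (hCel : 0 < Cel) (hH : 1 ≤ H) (hK : 2 ≤ K) (hBt : 1 ≤ Bt) (hBtK : Bt ≤ K)
    (hd : 0 ≤ d) (hκ : 0 ≤ κ) (hreal : D.Realizes M υstar μstar fstar) (hℓ : IsBoundedLoss ℓ R)
    (hT : IsDecomposable M ℓ fstar) (hel : L2EluderCondition M ℓ R Cel d K)
    (hι : 1 ≤ ι) (hβ : R ^ 2 * ι ≤ β) (ho : o ≤ 1)
    {fs : ℕ → F} {νs : ℕ → MarkovPolicy S B} {τs : ℕ → Trajectory S A B H}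
    (hexc : ∀ (h : Fin H) (f' : F) (g : G), ∀ k ≤ K, ∑ i ∈ Finset.Icc 1 k,
      excess (meanLoss M ℓ h (fs i) (τs i h).1 f' g) (ℓ h (fs i) (τs i h).2 (τs i h).1 f' g) ≤ β)
    (hdev : ∀ h : Fin H, ∑ i ∈ Finset.Icc 1 K,
        ∫ t, ‖meanLoss M ℓ h (fs i) (t h).1 (fs i) (fs i)‖
          ∂(M.rollout (D.maxPolicy (fs i)) (νs i) H 0 s₁) ≤
      2 * ∑ i ∈ Finset.Icc 1 K, ‖meanLoss M ℓ h (fs i) (τs i h).1 (fs i) (fs i)‖ +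
        2 * (R * √(Cel * d)) * ι)
    (hopt : ∀ k ∈ Finset.Icc 1 K, (confidenceSet ℓ β (K / Bt) o fs τs (k - 1)).Nonempty →
      fs k ∈ confidenceSet ℓ β (K / Bt) o fs τs (k - 1) ∧
      ∀ g ∈ confidenceSet ℓ β (K / Bt) o fs τs (k - 1), D.V g 0 s₁ ≤ D.V (fs k) 0 s₁)
    (keep : ∀ k ∈ Finset.Icc 1 K, k + 1 ≤ K → ¬ IsUpdate (K / Bt) o k → fs (k + 1) = fs k)
    (hdom : ∑ i ∈ Finset.Icc 1 K,
        (D.V (fs i) 0 s₁ - M.value (D.maxPolicy (fs i)) (νs i) 0 s₁) ≤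
      κ * ∑ h : Fin H, ∑ i ∈ Finset.Icc 1 K,
        ∫ t, ‖meanLoss M ℓ h (fs i) (t h).1 (fs i) (fs i)‖
          ∂(M.rollout (D.maxPolicy (fs i)) (νs i) H 0 s₁)) :
    regret M D s₁ υstar μstar K fs νs ≤
      (4 * √(8 * Cel) + 4 * √Cel + 16 * R * Cel) * (κ * H * √(d * β * K) * Real.log K +
        κ * (d * H * K / Bt) * Real.log K ^ 2) := by
  have hβ0 : 0 ≤ β := le_trans (by positivity) hβ
  have hstar : ∀ k ∈ Finset.Icc 1 K, fstar ∈ confidenceSet ℓ β (K / Bt) o fs τs (k - 1) :=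
    fun k hk => fstar_mem_confidenceSet hT hβ0 hexc (by
      have := Finset.mem_Icc.1 hk; omega)
  have hconf : ∀ k ∈ Finset.Icc 1 K, fs k ∈ confidenceSet ℓ β (K / Bt) o fs τs (k - 1) :=
    fun k hk => (hopt k hk ⟨fstar, hstar k hk⟩).1
  have hm : 1 ≤ K / Bt := Nat.div_pos hBtK hBt
  have hK1 : 1 ≤ K := by omega
  have hCd : 0 ≤ Cel * d := by positivity
  have hregret : regret M D s₁ υstar μstar K fs νs ≤ ∑ i ∈ Finset.Icc 1 K,
      (D.V (fs i) 0 s₁ - M.value (D.maxPolicy (fs i)) (νs i) 0 s₁) := by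
    refine Finset.sum_le_sum fun k hk => ?_
    have h1 := (hopt k hk ⟨fstar, hstar k hk⟩).2 fstar (hstar k hk)
    rw [(hreal 0 hH).2 s₁] at h1
    linarith
  have hstep : ∀ h : Fin H, ∑ i ∈ Finset.Icc 1 K,
      ∫ t, ‖meanLoss M ℓ h (fs i) (t h).1 (fs i) (fs i)‖
        ∂(M.rollout (D.maxPolicy (fs i)) (νs i) H 0 s₁) ≤
      (4 * √(8 * Cel) + 4 * √Cel + 16 * R * Cel) *
        (√(d * β * K) * Real.log K + d * K / Bt * Real.log K ^ 2) := by
    intro h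
    have hb : ∀ i, ‖meanLoss M ℓ h (fs i) (τs i h).1 (fs i) (fs i)‖ ≤ R := fun i =>
      norm_integral_trans_le M h _ fun ζ => hℓ.norm_le _ _ _ _ _ _
    refine expected_loss_sum_le (m := K / Bt) hR hCel hd hK hBt (zero_le_one.trans hι) hβ
      Nat.cast_div_le ?_ (Finset.sum_nonneg fun i _ => norm_nonneg _) (hdev h) ?_
    · rcases hR.eq_or_lt with hR0 | hR0
      · have hx : ∑ i ∈ Finset.Icc 1 K, ‖meanLoss M ℓ h (fs i) (τs i h).1 (fs i) (fs i)‖ ≤ 0 :=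
          Finset.sum_nonpos fun i _ => (hb i).trans hR0.ge
        refine hx.trans ?_
        rw [← hR0, zero_mul, add_zero]
        exact Real.sqrt_nonneg _
      · have hR2 : 0 < R ^ 2 := by positivity
        refine sum_norm_meanLoss_le (m := K / Bt) hel hT hm ho hCd hR (β := 4 * β)
          (by nlinarith) (by nlinarith) h fs (fun i => (τs i h).1) keep (fun k hk => ?_) hb
        have := Finset.mem_Icc.1 hk
        exact sum_sq_norm_meanLoss_le hT hβ0 hexc (by omega) (hconf k hk) h
    · have hle : ∀ i ∈ Finset.Icc 1 K, ∫ t, ‖meanLoss M ℓ h (fs i) (t h).1 (fs i) (fs i)‖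
          ∂(M.rollout (D.maxPolicy (fs i)) (νs i) H 0 s₁) ≤ R * √(Cel * d) := fun i _ => by
        refine (le_abs_self _).trans ?_
        have := norm_integral_le_of_norm_le_const
          (μ := M.rollout (D.maxPolicy (fs i)) (νs i) H 0 s₁)
          (f := fun t => ‖meanLoss M ℓ h (fs i) (t h).1 (fs i) (fs i)‖)
          (Filter.Eventually.of_forall fun t => (norm_norm _).trans_le
            (hel.norm_meanLoss_le hT hK1 hR hCd h (fs i) (t h).1))
        simpa using this
      simpa using Finset.sum_le_card_nsmul _ _ _ hle
  refine (hregret.trans hdom).trans ?_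
  refine (mul_le_mul_of_nonneg_left (Finset.sum_le_sum fun h _ => hstep h) hκ).trans
    (le_of_eq ?_)
  simp only [Finset.sum_const, Finset.card_univ, Fintype.card_fin, nsmul_eq_mul]
  ring

end Regret

theorem theorem2 :
    ∃ c₀ : ℝ, 0 < c₀ ∧ ∀ R Cel : ℝ, 0 ≤ R → 0 < Cel → ∃ C : ℝ, 0 < C ∧
      ∀ (S A B G : Type*) [MeasurableSpace S] [MeasurableSpace A] [MeasurableSpace B]
        [MeasurableSpace G] (F : Set G) (H p K Bt : ℕ) (M : MarkovGame S A B H) (s₁ : S)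
        (υstar : MarkovPolicy S A) (μstar : MarkovPolicy S B)
        (D : HypothesisData S A B F) (fstar : F) (ℓ : LossFunction S A B F H p) (d κ : ℝ),
        1 ≤ H → 2 ≤ K → 1 ≤ Bt → Bt ≤ K → 0 ≤ d → 0 ≤ κ →
        M.IsNash s₁ υstar μstar →
        D.IsGreedy H →
        D.Realizes M υstar μstar fstar →
        IsBoundedLoss ℓ R →
        IsDecomposable M ℓ fstar →
        L2EluderCondition M ℓ R Cel d K →
        ∀ N : ℕ, Metric.coveringNumber (1 / (K : NNReal)) (lossClass ℓ) = N →
        ∀ c δ β : ℝ, c₀ ≤ c → 0 < δ → δ < 1 →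
        β = c * (R ^ 2 * Real.log (H * K ^ 2 * N / δ) + R) →
        ∀ o : ℕ, o = 0 ∨ o = 1 →
        ∀ (Ω : Type*) (mΩ : MeasurableSpace Ω) (Pr : Measure Ω) [IsProbabilityMeasure Pr]
          (ℱ : Filtration ℕ mΩ) (f : ℕ → Ω → F) (ν : ℕ → Ω → MarkovPolicy S B)
          (τ : ℕ → Ω → Trajectory S A B H),
        IsBatchRun M D ℓ s₁ β K (K / Bt) o Pr ℱ f ν τ →
        ∀ δ₁ : ℝ, 0 ≤ δ₁ → Dominance M D ℓ s₁ κ δ₁ K Pr f ν →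
        1 - δ - δ₁ ≤ Pr.real {ω |
          regret M D s₁ υstar μstar K (fun k => f k ω) (fun k => ν k ω) ≤
            C * (κ * H * √(d * β * K) * Real.log K +
              κ * (d * H * K / Bt) * Real.log K ^ 2)} := by
  refine ⟨7, by norm_num, fun R Cel hR hCel => ⟨4 * √(8 * Cel) + 4 * √Cel + 16 * R * Cel,
    by positivity, ?_⟩⟩
  intro S A B G _ _ _ _ F H p K Bt M s₁ υstar μstar D fstar ℓ d κ hH hK hBt hBtK hd hκ _ _ hreal
    hℓ hT hel N hN c δ β hc hδ hδ1 hβ o ho Ω mΩ Pr _ ℱ f ν τ hrun δ₁ _ hdom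
  set ι := Real.log (H * K ^ 2 * N / δ) with hιdef
  have hCd : 0 ≤ Cel * d := by positivity
  have hN1 : 1 ≤ N := by
    have h1 : 0 < Metric.coveringNumber (1 / (K : NNReal)) (lossClass ℓ) :=
      Metric.coveringNumber_pos_iff.2 ⟨_, ⟨0, hH⟩, fstar, fstar, rfl⟩
    rw [hN] at h1
    exact_mod_cast h1
  have hι : 1 ≤ ι := one_le_log_count hH hN1 hK hδ hδ1
  have hι0 : 0 ≤ R ^ 2 * ι := by positivity
  have hβ7 : 7 * (R ^ 2 * ι + R) ≤ β := by
    rw [hβ]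
    exact mul_le_mul_of_nonneg_right hc (by positivity)
  set good := {ω | regret M D s₁ υstar μstar K (fun k => f k ω) (fun k => ν k ω) ≤
    (4 * √(8 * Cel) + 4 * √Cel + 16 * R * Cel) * (κ * H * √(d * β * K) * Real.log K +
      κ * (d * H * K / Bt) * Real.log K ^ 2)}
  set dom := {ω | ∑ i ∈ Finset.Icc 1 K,
        (D.V (f i ω) 0 s₁ - M.value (D.maxPolicy (f i ω)) (ν i ω) 0 s₁) ≤
      κ * ∑ h : Fin H, ∑ i ∈ Finset.Icc 1 K,
        ∫ t, ‖meanLoss M ℓ h (f i ω) (t h).1 (f i ω) (f i ω)‖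
          ∂(M.rollout (D.maxPolicy (f i ω)) (ν i ω) H 0 s₁)}
  set bad₁ := {ω | ¬ ∀ (h : Fin H) (f' : F) (g : G), ∀ k ≤ K, ∑ i ∈ Finset.Icc 1 k,
      excess (meanLoss M ℓ h (f i ω) (τ i ω h).1 f' g)
        (ℓ h (f i ω) (τ i ω h).2 (τ i ω h).1 f' g) ≤ 4 * R ^ 2 * ι + 7 * R}
  let bad₂ : Fin H → Set Ω := fun h => {ω | 2 * ∑ i ∈ Finset.Icc 1 K,
      ‖meanLoss M ℓ h (f i ω) (τ i ω h).1 (f i ω) (f i ω)‖ + 2 * (R * √(Cel * d)) * ι <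
        ∑ i ∈ Finset.Icc 1 K, ∫ t, ‖meanLoss M ℓ h (f i ω) (t h).1 (f i ω) (f i ω)‖
          ∂(M.rollout (D.maxPolicy (f i ω)) (ν i ω) H 0 s₁)}
  have hPbad : Pr (bad₁ ∪ ⋃ h : Fin H, bad₂ h) ≤ ENNReal.ofReal δ := by
    refine (measure_union_le _ _).trans
      (le_trans (add_le_add ?_ ?_) (failure_probability_le hH hN1 hK hδ))
    · exact hrun.measure_exists_lt_sum_excess hR hℓ (by omega) hN (zero_le_one.trans hι)
    · refine (measure_iUnion_fintype_le _ _).trans ?_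
      refine (Finset.sum_le_card_nsmul _ _ _ fun h _ =>
        hrun.measure_lt_sum_integral_norm_meanLoss hℓ.measurable_diag (by positivity) h
          (fun f' η => hel.norm_meanLoss_le hT (by omega) hR hCd h f' η) ι).trans (le_of_eq ?_)
      rw [Finset.card_univ, Fintype.card_fin, nsmul_eq_mul]
  have hsub : dom ≤ᵐ[Pr] (good ∪ (bad₁ ∪ ⋃ h : Fin H, bad₂ h) : Set Ω) := by
    have hopt := (Finset.eventually_all _).2 hrun.optimistic
    have hkeep : ∀ᵐ ω ∂Pr, ∀ k ∈ Finset.Icc 1 K, k + 1 ≤ K → ¬ IsUpdate (K / Bt) o k →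
        f (k + 1) ω = f k ω := by
      refine (Finset.eventually_all _).2 fun k hk => ?_
      by_cases h : k + 1 ≤ K ∧ ¬ IsUpdate (K / Bt) o k
      · filter_upwards [hrun.keep k hk h.1 h.2] with ω hω _ _ using hω
      · exact Filter.Eventually.of_forall fun ω h1 h2 => absurd ⟨h1, h2⟩ h
    filter_upwards [hopt, hkeep] with ω hω hω' hωd
    by_contra hnot
    change ω ∉ good ∪ (bad₁ ∪ ⋃ h, bad₂ h) at hnot
    simp only [Set.mem_union, Set.mem_iUnion, not_or, not_exists] at hnot
    obtain ⟨hng, hnb₁, hnb₂⟩ := hnot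
    refine hng (regret_le_of_concentration (ι := ι) hR hCel hH hK hBt hBtK hd hκ hreal hℓ hT hel hι
      (by linarith) (by omega) (fun h f' g k hk => ?_) (fun h => not_lt.1 (hnb₂ h)) hω hω' hωd)
    have := not_not.1 hnb₁ h f' g k hk
    linarith
  have hmeas : Pr dom ≤ Pr good + ENNReal.ofReal δ :=
    (measure_mono_ae hsub).trans ((measure_union_le _ _).trans (add_le_add le_rfl hPbad))
  have hreal' : Pr.real dom ≤ Pr.real good + δ := by
    have h1 := ENNReal.toReal_mono (by finiteness) hmeas
    rwa [ENNReal.toReal_add (measure_ne_top _ _) ENNReal.ofReal_ne_top,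
      ENNReal.toReal_ofReal hδ.le] at h1
  have := hdom K (Finset.mem_Icc.2 ⟨by omega, le_rfl⟩)
  change 1 - δ₁ ≤ Pr.real dom at this
  linarith
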